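/- Let $I=[0,1]$, let $I^2\subset\mathbb R^2$ be the unit square and $\partial I^2$ its boundary. Let $\mathrm{PL}(I^2,\partial I^2)$ be the group, under composition, of all homeomorphisms $f\colon I^2\to I^2$ that fix every point of $\partial I^2$ and are piecewise linear, meaning that there is a finite triangulation of $I^2$ such that on each of its simplices $f$ is linear (that is, agrees with an affine map). A group $G$ is called locally indicable if every nontrivial finitely generated subgroup of $G$ admits a surjective homomorphism onto $\mathbb Z$, and left-orderable if it has a strict total order $<$ such that $g<h$ implies $fg<fh$ for all $f,g,h\in G$. Theorem (Calegari–Rolfsen). The group $\mathrm{PL}(I^2,\partial I^2)$ is locally indicable, and therefore left-orderable. -/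

import Mathlib

namespace PLHomeo

section General

variable {E : Type*} [NormedAddCommGroup E] [NormedSpace ℝ E]

/-- A self-homeomorphism `f` of a subset `X` of a real vector space is piecewise linear if `X` has
a finite triangulation (a finite geometric simplicial complex with underlying space `X`) such that
`f` is linear, that is, the restriction of an affine map, on each simplex. -/
def IsPL (X : Set E) (f : X ≃ₜ X) : Prop :=
  ∃ K : Geometry.SimplicialComplex ℝ E, K.faces.Finite ∧ K.space = X ∧
    ∀ s ∈ K.faces, ∃ A : E →ᵃ[ℝ] E,
      ∀ x : X, (x : E) ∈ convexHull ℝ (s : Set E) → (f x : E) = A x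

/-! ### Auxiliary facts: piecewise linear homeomorphisms form a group

The identity, composites and inverses are shown to be linear on the simplices of a suitable
triangulation, namely the barycentric subdivision of the cell decomposition cut out by the
zero sets of finitely many affine functions. -/

/-- `y` lies in the closed cell spanned by `x`, for the cell decomposition given by `F`. -/
def Dom (F : Finset (E →ᵃ[ℝ] ℝ)) (y x : E) : Prop :=
  ∀ l ∈ F, (0 ≤ l x → 0 ≤ l y) ∧ (l x ≤ 0 → l y ≤ 0)

theorem Dom.refl (F : Finset (E →ᵃ[ℝ] ℝ)) (x : E) : Dom F x x := fun _ _ => ⟨id, id⟩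

theorem Dom.trans {F : Finset (E →ᵃ[ℝ] ℝ)} {x y z : E} (h : Dom F x y) (h' : Dom F y z) :
    Dom F x z :=
  fun l hl => ⟨fun q => (h l hl).1 ((h' l hl).1 q), fun q => (h l hl).2 ((h' l hl).2 q)⟩

theorem Dom.mono {F G : Finset (E →ᵃ[ℝ] ℝ)} {x y : E} (h : Dom G x y) (hFG : F ⊆ G) :
    Dom F x y := fun l hl => h l (hFG hl)

theorem aff_eq {V W : Type*} [AddCommGroup V] [Module ℝ V] [AddCommGroup W] [Module ℝ W]
    (A : V →ᵃ[ℝ] W) (x : V) : A x = A.linear x + A 0 := by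
  rw [AffineMap.decomp' A]; simp

theorem aff_sum' {V W : Type*} [AddCommGroup V] [Module ℝ V] [AddCommGroup W] [Module ℝ W]
    {ι : Type*} (A : V →ᵃ[ℝ] W) (s : Finset ι) (w : ι → ℝ) (p : ι → V) :
    ∑ z ∈ s, w z • A (p z) = A.linear (∑ z ∈ s, w z • p z) + (∑ z ∈ s, w z) • A 0 := by
  have h : ∀ z ∈ s, w z • A (p z) = A.linear (w z • p z) + w z • A 0 := by
    intro z _
    rw [aff_eq A (p z), smul_add, map_smul]
  rw [Finset.sum_congr rfl h, Finset.sum_add_distrib, map_sum, Finset.sum_smul]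

theorem aff_sum {V W : Type*} [AddCommGroup V] [Module ℝ V] [AddCommGroup W] [Module ℝ W]
    {ι : Type*} (A : V →ᵃ[ℝ] W) (s : Finset ι) (w : ι → ℝ) (p : ι → V) (hw : ∑ z ∈ s, w z = 1) :
    A (∑ z ∈ s, w z • p z) = ∑ z ∈ s, w z • A (p z) := by
  rw [aff_sum', hw, one_smul, ← aff_eq]

theorem dom_of_mem_convexHull {F : Finset (E →ᵃ[ℝ] ℝ)} {s : Finset E} {x y : E}
    (hs : ∀ z ∈ s, Dom F z x) (hy : y ∈ convexHull ℝ (s : Set E)) : Dom F y x := by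
  obtain ⟨w, hw0, hw1, rfl⟩ := Finset.mem_convexHull'.1 hy
  intro l hl
  rw [aff_sum l s w (fun z => z) hw1]
  refine ⟨fun q => Finset.sum_nonneg fun z hz => ?_, fun q => Finset.sum_nonpos fun z hz => ?_⟩
  · exact mul_nonneg (hw0 z hz) ((hs z hz l hl).1 q)
  · exact mul_nonpos_of_nonneg_of_nonpos (hw0 z hz) ((hs z hz l hl).2 q)

/-- A choice of one point in each open cell. -/
theorem exists_rep (F : Finset (E →ᵃ[ℝ] ℝ)) : ∃ r : E → E, (Set.range r).Finite ∧
    (∀ x, Dom F (r x) x ∧ Dom F x (r x)) ∧ ∀ x y, Dom F x y → Dom F y x → r x = r y := by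
  classical
  let sg : E → (F → SignType) := fun x l => SignType.sign (l.1 x)
  have hsg : ∀ x y, sg x = sg y → Dom F x y := by
    intro x y h l hl
    have h1 : SignType.sign (l x) = SignType.sign (l y) := congrFun h ⟨l, hl⟩
    rcases lt_trichotomy (l y) 0 with h2 | h2 | h2
    · rw [sign_neg h2, sign_eq_neg_one_iff] at h1
      exact ⟨fun q => by linarith, fun _ => h1.le⟩
    · rw [h2, sign_zero, sign_eq_zero_iff] at h1
      exact ⟨fun _ => h1.ge, fun _ => h1.le⟩
    · rw [sign_pos h2, sign_eq_one_iff] at h1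
      exact ⟨fun _ => h1.le, fun q => by linarith⟩
  have hsg' : ∀ x y, Dom F x y → Dom F y x → sg x = sg y := by
    intro x y h h'
    funext l
    change SignType.sign (l.1 x) = SignType.sign (l.1 y)
    have a := h l.1 l.2
    have b := h' l.1 l.2
    rcases lt_trichotomy (l.1 y) 0 with h2 | h2 | h2
    · rw [sign_neg h2, sign_eq_neg_one_iff]
      by_contra hc
      linarith [b.1 (not_lt.1 hc)]
    · rw [h2, sign_zero, sign_eq_zero_iff]
      exact le_antisymm (a.2 h2.le) (a.1 h2.ge)
    · rw [sign_pos h2, sign_eq_one_iff]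
      by_contra hc
      linarith [b.2 (not_lt.1 hc)]
  refine ⟨fun x => Function.invFun sg (sg x), ?_, ?_, ?_⟩
  · exact (Set.finite_range (Function.invFun sg)).subset
      (by rintro _ ⟨x, rfl⟩; exact ⟨sg x, rfl⟩)
  · intro x
    have : sg (Function.invFun sg (sg x)) = sg x := Function.invFun_eq ⟨x, rfl⟩
    exact ⟨hsg _ _ this, hsg _ _ this.symm⟩
  · intro x y h h'
    change Function.invFun sg (sg x) = Function.invFun sg (sg y)
    rw [hsg' x y h h']

/-- Affine independence follows from uniqueness of convex coordinates. -/
theorem indep_of_unique {V ι : Type*} [AddCommGroup V] [Module ℝ V] [Fintype ι] (p : ι → V)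
    (h : ∀ w v : ι → ℝ, (∀ i, 0 ≤ w i) → (∀ i, 0 ≤ v i) → ∑ i, w i = 1 → ∑ i, v i = 1 →
      ∑ i, w i • p i = ∑ i, v i • p i → w = v) : AffineIndependent ℝ p := by
  classical
  rw [affineIndependent_iff_of_fintype]
  intro c hc0 hc1
  rw [Finset.univ.weightedVSub_eq_linear_combination hc0] at hc1
  set P : ℝ := ∑ i, max (c i) 0 with hP
  have hN : ∑ i, max (-c i) 0 = P := by
    have : ∑ i, (max (c i) 0 - max (-c i) 0) = ∑ i, c i := by
      refine Finset.sum_congr rfl fun i _ => ?_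
      rcases le_total (c i) 0 with q | q
      · rw [max_eq_right q, max_eq_left (by linarith)]; ring
      · rw [max_eq_left q, max_eq_right (by linarith)]; ring
    rw [Finset.sum_sub_distrib, hc0] at this
    linarith
  by_cases hP0 : P = 0
  · have h1 := (Finset.sum_eq_zero_iff_of_nonneg (fun i _ => le_max_right (c i) 0)).1 hP0
    have h2 := (Finset.sum_eq_zero_iff_of_nonneg (fun i _ => le_max_right (-c i) 0)).1
      (hN.trans hP0)
    intro i
    have a := h1 i (Finset.mem_univ i)
    have b := h2 i (Finset.mem_univ i)
    have a' := le_max_left (c i) 0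
    have b' := le_max_left (-c i) 0
    linarith
  · have hPpos : 0 < P := lt_of_le_of_ne
      (Finset.sum_nonneg fun i _ => le_max_right (c i) 0) (Ne.symm hP0)
    have hsum : ∑ i, max (c i) 0 • p i = ∑ i, max (-c i) 0 • p i := by
      rw [← sub_eq_zero, ← Finset.sum_sub_distrib, ← hc1]
      refine Finset.sum_congr rfl fun i _ => ?_
      rw [← sub_smul]
      congr 1
      rcases le_total (c i) 0 with q | q
      · rw [max_eq_right q, max_eq_left (by linarith)]; ring
      · rw [max_eq_left q, max_eq_right (by linarith)]; ring
    have := h (fun i => P⁻¹ * max (c i) 0) (fun i => P⁻¹ * max (-c i) 0)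
      (fun i => mul_nonneg (inv_nonneg.2 hPpos.le) (le_max_right _ _))
      (fun i => mul_nonneg (inv_nonneg.2 hPpos.le) (le_max_right _ _))
      (by rw [← Finset.mul_sum, ← hP, inv_mul_cancel₀ hP0])
      (by rw [← Finset.mul_sum, hN, inv_mul_cancel₀ hP0])
      (by simp_rw [mul_smul, ← Finset.smul_sum, hsum])
    intro i
    have h3 := mul_left_cancel₀ (inv_ne_zero hP0) (congrFun this i)
    rcases le_total (c i) 0 with q | q
    · rw [max_eq_right q, max_eq_left (by linarith)] at h3; linarith
    · rw [max_eq_left q, max_eq_right (by linarith)] at h3; linarith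

/-- Uniqueness of coordinates with respect to vertices lying in a chain of cells. -/
theorem unique_coords (F : Finset (E →ᵃ[ℝ] ℝ)) (B : Finset E)
    (hB : ∀ x ∈ B, ∀ y ∈ B, Dom F x y → Dom F y x → x = y) (n : ℕ) :
    ∀ w v : E → ℝ, (B.filter (w · ≠ 0)).card + (B.filter (v · ≠ 0)).card ≤ n →
      (∀ z ∈ B, 0 ≤ w z) → (∀ z ∈ B, 0 ≤ v z) →
      (∀ x ∈ B, ∀ y ∈ B, w x ≠ 0 → w y ≠ 0 → Dom F x y ∨ Dom F y x) →
      (∀ x ∈ B, ∀ y ∈ B, v x ≠ 0 → v y ≠ 0 → Dom F x y ∨ Dom F y x) →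
      ∑ z ∈ B, w z = ∑ z ∈ B, v z → ∑ z ∈ B, w z • z = ∑ z ∈ B, v z • z →
      ∀ z ∈ B, w z = v z := by
  classical
  -- a chain has a top element
  have top : ∀ s : Finset E, s.Nonempty → (∀ x ∈ s, ∀ y ∈ s, Dom F x y ∨ Dom F y x) →
      ∃ p ∈ s, ∀ x ∈ s, Dom F x p := by
    intro s hs
    induction hs using Finset.Nonempty.cons_induction with
    | singleton a =>
      intro _
      exact ⟨a, by simp, fun x hx => by rw [Finset.mem_singleton.1 hx]; exact Dom.refl F a⟩
    | cons a s ha hs ih =>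
      intro h
      obtain ⟨p, hp, hp'⟩ := ih fun x hx y hy =>
        h x (Finset.mem_cons_of_mem hx) y (Finset.mem_cons_of_mem hy)
      rcases h a (Finset.mem_cons_self a s) p (Finset.mem_cons_of_mem hp) with q | q
      · refine ⟨p, Finset.mem_cons_of_mem hp, fun x hx => ?_⟩
        rcases Finset.mem_cons.1 hx with rfl | hx
        · exact q
        · exact hp' x hx
      · refine ⟨a, Finset.mem_cons_self a s, fun x hx => ?_⟩
        rcases Finset.mem_cons.1 hx with rfl | hx
        · exact Dom.refl F x
        · exact (hp' x hx).trans q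
  -- if the top elements differ, the values of some function differ in sign
  have key : ∀ (w v : E → ℝ) (p q : E), p ∈ B → q ∈ B → (∀ z ∈ B, 0 ≤ w z) → (∀ z ∈ B, 0 ≤ v z) →
      w p ≠ 0 → (∀ z ∈ B, w z ≠ 0 → Dom F z p) → (∀ z ∈ B, v z ≠ 0 → Dom F z q) →
      ∑ z ∈ B, w z = ∑ z ∈ B, v z → ∑ z ∈ B, w z • z = ∑ z ∈ B, v z • z → Dom F p q := by
    intro w v p q hp hq hw hv hwp hwd hvd h1 h2 l hl
    have hl' : ∑ z ∈ B, w z * l z = ∑ z ∈ B, v z * l z := by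
      have a := aff_sum' l B w (fun z => z)
      have b := aff_sum' l B v (fun z => z)
      simp only [smul_eq_mul] at a b
      rw [a, b, h1, h2]
    have hwp' : 0 < w p := lt_of_le_of_ne (hw p hp) (Ne.symm hwp)
    constructor
    · intro hlq
      by_contra hc
      push Not at hc
      have hneg : ∑ z ∈ B, w z * l z < 0 := by
        refine Finset.sum_neg' (fun z hz => ?_) ⟨p, hp, mul_neg_of_pos_of_neg hwp' hc⟩
        by_cases hz0 : w z = 0
        · simp [hz0]
        · exact mul_nonpos_of_nonneg_of_nonpos (hw z hz) ((hwd z hz hz0 l hl).2 hc.le)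
      have hpos : 0 ≤ ∑ z ∈ B, v z * l z := by
        refine Finset.sum_nonneg fun z hz => ?_
        by_cases hz0 : v z = 0
        · simp [hz0]
        · exact mul_nonneg (hv z hz) ((hvd z hz hz0 l hl).1 hlq)
      linarith
    · intro hlq
      by_contra hc
      push Not at hc
      have hneg : 0 < ∑ z ∈ B, w z * l z := by
        refine Finset.sum_pos' (fun z hz => ?_) ⟨p, hp, mul_pos hwp' hc⟩
        by_cases hz0 : w z = 0
        · simp [hz0]
        · exact mul_nonneg (hw z hz) ((hwd z hz hz0 l hl).1 hc.le)
      have hpos : ∑ z ∈ B, v z * l z ≤ 0 := by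
        refine Finset.sum_nonpos fun z hz => ?_
        by_cases hz0 : v z = 0
        · simp [hz0]
        · exact mul_nonpos_of_nonneg_of_nonpos (hv z hz) ((hvd z hz hz0 l hl).2 hlq)
      linarith
  induction n with
  | zero =>
    intro w v hn _ _ _ _ _ _ z hz
    have h1 : B.filter (w · ≠ 0) = ∅ := Finset.card_eq_zero.1 (by omega)
    have h2 : B.filter (v · ≠ 0) = ∅ := Finset.card_eq_zero.1 (by omega)
    have a : w z = 0 := by
      by_contra hc
      exact Finset.notMem_empty z (h1 ▸ Finset.mem_filter.2 ⟨hz, hc⟩)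
    have b : v z = 0 := by
      by_contra hc
      exact Finset.notMem_empty z (h2 ▸ Finset.mem_filter.2 ⟨hz, hc⟩)
    rw [a, b]
  | succ n ih =>
    intro w v hn hw hv hwc hvc h1 h2
    rcases (B.filter (w · ≠ 0)).eq_empty_or_nonempty with he | hne
    · have hw0 : ∀ z ∈ B, w z = 0 := by
        intro z hz
        by_contra hc
        exact Finset.notMem_empty z (he ▸ Finset.mem_filter.2 ⟨hz, hc⟩)
      rw [Finset.sum_eq_zero hw0] at h1
      intro z hz
      rw [hw0 z hz, (Finset.sum_eq_zero_iff_of_nonneg hv).1 h1.symm z hz]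
    rcases (B.filter (v · ≠ 0)).eq_empty_or_nonempty with he | hne'
    · have hv0 : ∀ z ∈ B, v z = 0 := by
        intro z hz
        by_contra hc
        exact Finset.notMem_empty z (he ▸ Finset.mem_filter.2 ⟨hz, hc⟩)
      rw [Finset.sum_eq_zero hv0] at h1
      intro z hz
      rw [hv0 z hz, (Finset.sum_eq_zero_iff_of_nonneg hw).1 h1 z hz]
    obtain ⟨p, hp, hpt⟩ := top _ hne fun x hx y hy =>
      hwc x (Finset.mem_filter.1 hx).1 y (Finset.mem_filter.1 hy).1
        (Finset.mem_filter.1 hx).2 (Finset.mem_filter.1 hy).2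
    obtain ⟨q, hq, hqt⟩ := top _ hne' fun x hx y hy =>
      hvc x (Finset.mem_filter.1 hx).1 y (Finset.mem_filter.1 hy).1
        (Finset.mem_filter.1 hx).2 (Finset.mem_filter.1 hy).2
    rw [Finset.mem_filter] at hp hq
    have hwd : ∀ z ∈ B, w z ≠ 0 → Dom F z p := fun z hz h => hpt z (Finset.mem_filter.2 ⟨hz, h⟩)
    have hvd : ∀ z ∈ B, v z ≠ 0 → Dom F z q := fun z hz h => hqt z (Finset.mem_filter.2 ⟨hz, h⟩)
    obtain rfl : p = q := hB p hp.1 q hq.1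
      (key w v p q hp.1 hq.1 hw hv hp.2 hwd hvd h1 h2)
      (key v w q p hq.1 hp.1 hv hw hq.2 hvd hwd h1.symm h2.symm)
    set m : ℝ := min (w p) (v p) with hm
    have hsub : ∀ u : E → ℝ, m ≤ u p → (∀ z ∈ B, 0 ≤ u z) →
        ∀ z ∈ B, 0 ≤ u z - (if z = p then m else 0) := by
      intro u hu hu0 z hz
      split_ifs with h
      · rw [h]; linarith
      · rw [sub_zero]; exact hu0 z hz
    have hsupp : ∀ u : E → ℝ, u p ≠ 0 → ∀ z, u z - (if z = p then m else 0) ≠ 0 → u z ≠ 0 := by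
      intro u hu z h h0
      by_cases hzp : z = p
      · exact hu (hzp ▸ h0)
      · rw [if_neg hzp, h0] at h; simp at h
    have hcard : ∀ u : E → ℝ, u p ≠ 0 →
        B.filter (fun z => u z - (if z = p then m else 0) ≠ 0) ⊆ B.filter (u · ≠ 0) := by
      intro u hu z hz
      rw [Finset.mem_filter] at hz ⊢
      exact ⟨hz.1, hsupp u hu z hz.2⟩
    have hcard' : ∀ u : E → ℝ, u p ≠ 0 → m = u p →
        (B.filter (fun z => u z - (if z = p then m else 0) ≠ 0)).card
          < (B.filter (u · ≠ 0)).card := by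
      intro u hu hmu
      refine Finset.card_lt_card (Finset.ssubset_iff_subset_ne.2 ⟨hcard u hu, fun he => ?_⟩)
      have : p ∈ B.filter (u · ≠ 0) := Finset.mem_filter.2 ⟨hp.1, hu⟩
      rw [← he, Finset.mem_filter] at this
      exact this.2 (by simp [hmu])
    have hfin := ih (fun z => w z - (if z = p then m else 0))
      (fun z => v z - (if z = p then m else 0))
      (by
        have a := Finset.card_le_card (hcard w hp.2)
        have b := Finset.card_le_card (hcard v hq.2)
        rcases min_choice (w p) (v p) with q | q
        · have := hcard' w hp.2 q; omega
        · have := hcard' v hq.2 q; omega)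
      (hsub w (min_le_left _ _) hw) (hsub v (min_le_right _ _) hv)
      (fun x hx y hy hx' hy' => hwc x hx y hy (hsupp w hp.2 x hx') (hsupp w hp.2 y hy'))
      (fun x hx y hy hx' hy' => hvc x hx y hy (hsupp v hq.2 x hx') (hsupp v hq.2 y hy'))
      (by simp only [Finset.sum_sub_distrib, h1])
      (by simp only [sub_smul, Finset.sum_sub_distrib, h2])
    intro z hz
    have := hfin z hz
    simpa using this

/-- The ray from `b` through a point `x` of the same open cell leaves that cell. -/
theorem exists_exit (F : Finset (E →ᵃ[ℝ] ℝ)) {X : Set E} (hXb : Bornology.IsBounded X)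
    (hX : ∀ x ∈ X, ∀ y, Dom F y x → y ∈ X) {b x : E} (hx : x ∈ X) (hbx : b ≠ x)
    (h1 : Dom F b x) :
    ∃ y, ∃ t : ℝ, Dom F y x ∧ ¬ Dom F x y ∧ 1 ≤ t ∧ y = b + t • (x - b) := by
  have hl : ∀ (l : E →ᵃ[ℝ] ℝ) (t : ℝ), l (b + t • (x - b)) = l b + t * (l x - l b) := by
    intro l t
    rw [aff_eq l (b + t • (x - b)), aff_eq l x, aff_eq l b]
    simp only [map_add, map_smul, map_sub, smul_eq_mul]
    ring
  set S : Set ℝ := {t | 1 ≤ t ∧ Dom F (b + t • (x - b)) x} with hS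
  have hclosed : IsClosed S := by
    have : S = Set.Ici 1 ∩ ⋂ l ∈ F, ({t : ℝ | 0 ≤ l x → 0 ≤ l b + t * (l x - l b)} ∩
        {t : ℝ | l x ≤ 0 → l b + t * (l x - l b) ≤ 0}) := by
      ext t
      simp only [hS, Dom, hl, Set.mem_ofPred_eq, Set.mem_inter_iff, Set.mem_Ici, Set.mem_iInter]
    rw [this]
    refine isClosed_Ici.inter (isClosed_biInter fun l _ => IsClosed.inter ?_ ?_)
    · by_cases q : 0 ≤ l x
      · simp only [q, true_imp_iff]
        exact isClosed_le continuous_const (by fun_prop)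
      · simp [q]
    · by_cases q : l x ≤ 0
      · simp only [q, true_imp_iff]
        exact isClosed_le (by fun_prop) continuous_const
      · simp [q]
  have hbdd : Bornology.IsBounded S := by
    obtain ⟨R, hR⟩ := hXb.exists_norm_le
    have hpos : 0 < ‖x - b‖ := norm_pos_iff.2 (sub_ne_zero.2 (Ne.symm hbx))
    refine (Metric.isBounded_Icc (1 : ℝ) ((R + ‖b‖) / ‖x - b‖)).subset fun t ht => ⟨ht.1, ?_⟩
    rw [le_div_iff₀ hpos]
    have a := hR _ (hX x hx _ ht.2)
    have c : ‖t • (x - b)‖ ≤ ‖b + t • (x - b)‖ + ‖b‖ := by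
      have := norm_sub_le (b + t • (x - b)) b
      rwa [add_sub_cancel_left] at this
    rw [norm_smul, Real.norm_eq_abs, abs_of_nonneg (zero_le_one.trans ht.1)] at c
    linarith
  have hne : S.Nonempty := ⟨1, le_rfl, by simpa using Dom.refl F x⟩
  obtain ⟨t, htS, htm⟩ := (Metric.isCompact_of_isClosed_isBounded hclosed hbdd).exists_isGreatest hne
  refine ⟨_, t, htS.2, fun hd => ?_, htS.1, rfl⟩
  have hev : ∀ᶠ u in nhds t, ∀ l ∈ F, (0 ≤ l x → 0 ≤ l b + u * (l x - l b)) ∧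
      (l x ≤ 0 → l b + u * (l x - l b) ≤ 0) := by
    rw [Filter.eventually_all_finset]
    intro l hlF
    have hc : Continuous fun u : ℝ => l b + u * (l x - l b) := by fun_prop
    have hdl := hd l hlF
    rw [hl] at hdl
    have hbl := h1 l hlF
    rcases lt_trichotomy (l x) 0 with q | q | q
    · have : l b + t * (l x - l b) < 0 := by
        by_contra hc
        linarith [hdl.1 (not_lt.1 hc)]
      filter_upwards [hc.continuousAt.eventually_lt continuousAt_const this] with u hu
      exact ⟨fun q' => by linarith, fun _ => hu.le⟩
    · have hb0 : l b = 0 := le_antisymm (hbl.2 q.le) (hbl.1 q.ge)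
      refine Filter.Eventually.of_forall fun u => ?_
      simp [hb0, q]
    · have : 0 < l b + t * (l x - l b) := by
        by_contra hc
        linarith [hdl.2 (not_lt.1 hc)]
      filter_upwards [continuousAt_const.eventually_lt hc.continuousAt this] with u hu
      exact ⟨fun _ => hu.le, fun q' => by linarith⟩
  obtain ⟨u, hu, hut⟩ := ((hev.filter_mono nhdsWithin_le_nhds).and
    (self_mem_nhdsWithin : Set.Ioi t ∈ nhdsWithin t (Set.Ioi t))).exists
  have : u ∈ S := ⟨htS.1.trans (le_of_lt hut), fun l hlF => by rw [hl]; exact hu l hlF⟩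
  exact absurd (htm this) (not_le.2 hut)

/-- A bounded union of closed cells has a finite triangulation refining the cells. -/
theorem exists_triangulation (F : Finset (E →ᵃ[ℝ] ℝ)) {X : Set E} (hXb : Bornology.IsBounded X)
    (hX : ∀ x ∈ X, ∀ y, Dom F y x → y ∈ X) :
    ∃ K : Geometry.SimplicialComplex ℝ E, K.faces.Finite ∧ K.space = X ∧
      ∀ s ∈ K.faces, ∃ x ∈ X, ∀ y ∈ convexHull ℝ (s : Set E), Dom F y x := by
  classical
  obtain ⟨r, hrf, hr, hr'⟩ := exists_rep F
  let face : Finset E → Prop := fun s => s.Nonempty ∧ (∀ z ∈ s, z ∈ X ∧ r z = z) ∧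
    ∀ x ∈ s, ∀ y ∈ s, Dom F x y ∨ Dom F y x
  have hfix : ∀ x y, r x = x → r y = y → Dom F x y → Dom F y x → x = y := by
    intro x y hx hy h h'
    rw [← hx, ← hy, hr' x y h h']
  have huniq : ∀ s t, face s → face t → ∀ w v : E → ℝ, (∀ z ∈ s, 0 ≤ w z) → (∀ z ∈ t, 0 ≤ v z) →
      ∑ z ∈ s, w z = 1 → ∑ z ∈ t, v z = 1 → ∑ z ∈ s, w z • z = ∑ z ∈ t, v z • z →
      ∀ z ∈ s ∪ t, (if z ∈ s then w z else 0) = (if z ∈ t then v z else 0) := by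
    intro s t hs ht w v hw hv hw1 hv1 he
    have hs' : s ⊆ s ∪ t := Finset.subset_union_left
    have ht' : t ⊆ s ∪ t := Finset.subset_union_right
    have hsum : ∀ a : Finset E, a ⊆ s ∪ t → ∀ u : E → ℝ,
        ∑ z ∈ s ∪ t, (if z ∈ a then u z else 0) = ∑ z ∈ a, u z := by
      intro a ha u
      rw [← Finset.sum_filter, Finset.filter_mem_eq_inter, Finset.inter_eq_right.2 ha]
    have hsum' : ∀ a : Finset E, a ⊆ s ∪ t → ∀ u : E → ℝ,
        ∑ z ∈ s ∪ t, (if z ∈ a then u z else 0) • z = ∑ z ∈ a, u z • z := by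
      intro a ha u
      simp only [ite_smul, zero_smul]
      rw [← Finset.sum_filter, Finset.filter_mem_eq_inter, Finset.inter_eq_right.2 ha]
    refine unique_coords F (s ∪ t) ?_ _ _ _ le_rfl ?_ ?_ ?_ ?_ ?_ ?_
    · intro x hx y hy
      refine hfix x y ?_ ?_
      · rcases Finset.mem_union.1 hx with h | h
        · exact (hs.2.1 x h).2
        · exact (ht.2.1 x h).2
      · rcases Finset.mem_union.1 hy with h | h
        · exact (hs.2.1 y h).2
        · exact (ht.2.1 y h).2
    · intro z _
      split_ifs with h
      · exact hw z h
      · exact le_rfl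
    · intro z _
      split_ifs with h
      · exact hv z h
      · exact le_rfl
    · intro x _ y _ hx hy
      by_cases h : x ∈ s
      · by_cases h' : y ∈ s
        · exact hs.2.2 x h y h'
        · simp [h'] at hy
      · simp [h] at hx
    · intro x _ y _ hx hy
      by_cases h : x ∈ t
      · by_cases h' : y ∈ t
        · exact ht.2.2 x h y h'
        · simp [h'] at hy
      · simp [h] at hx
    · rw [hsum s hs', hsum t ht', hw1, hv1]
    · rw [hsum' s hs', hsum' t ht', he]
  have htop : ∀ s, face s → ∃ x ∈ X, ∀ z ∈ s, Dom F z x := by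
    have : ∀ s : Finset E, s.Nonempty → (∀ z ∈ s, z ∈ X) →
        (∀ x ∈ s, ∀ y ∈ s, Dom F x y ∨ Dom F y x) → ∃ x ∈ s, ∀ z ∈ s, Dom F z x := by
      intro s hs
      induction hs using Finset.Nonempty.cons_induction with
      | singleton a =>
        intro _ _
        exact ⟨a, by simp, fun x hx => by rw [Finset.mem_singleton.1 hx]; exact Dom.refl F a⟩
      | cons a s ha hs ih =>
        intro h0 h
        obtain ⟨p, hp, hp'⟩ := ih (fun z hz => h0 z (Finset.mem_cons_of_mem hz)) fun x hx y hy =>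
          h x (Finset.mem_cons_of_mem hx) y (Finset.mem_cons_of_mem hy)
        rcases h a (Finset.mem_cons_self a s) p (Finset.mem_cons_of_mem hp) with q | q
        · refine ⟨p, Finset.mem_cons_of_mem hp, fun x hx => ?_⟩
          rcases Finset.mem_cons.1 hx with rfl | hx
          · exact q
          · exact hp' x hx
        · refine ⟨a, Finset.mem_cons_self a s, fun x hx => ?_⟩
          rcases Finset.mem_cons.1 hx with rfl | hx
          · exact Dom.refl F x
          · exact (hp' x hx).trans q
    intro s hs
    obtain ⟨x, hx, h⟩ := this s hs.1 (fun z hz => (hs.2.1 z hz).1) hs.2.2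
    exact ⟨x, (hs.2.1 x hx).1, h⟩
  have hcover : ∀ n : ℕ, ∀ x ∈ X, (F.filter fun l => l x ≠ 0).card ≤ n →
      ∃ s, face s ∧ x ∈ convexHull ℝ (s : Set E) ∧ ∀ z ∈ s, Dom F z x := by
    intro n
    induction n using Nat.strong_induction_on with
    | _ n ih =>
      intro x hx hn
      by_cases hrx : r x = x
      · refine ⟨{x}, ⟨by simp, ?_, ?_⟩, by simp, ?_⟩
        · intro z hz; rw [Finset.mem_singleton.1 hz]; exact ⟨hx, hrx⟩
        · intro y hy z hz
          rw [Finset.mem_singleton.1 hy, Finset.mem_singleton.1 hz]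
          exact Or.inl (Dom.refl F x)
        · intro z hz; rw [Finset.mem_singleton.1 hz]; exact Dom.refl F x
      · obtain ⟨y, t, hyx, hxy, ht, hy⟩ := exists_exit F hXb hX hx hrx (hr x).1
        have hlt : (F.filter fun l => l y ≠ 0).card < (F.filter fun l => l x ≠ 0).card := by
          refine Finset.card_lt_card (Finset.ssubset_iff_subset_ne.2 ⟨?_, fun he => hxy ?_⟩)
          · intro l hl
            rw [Finset.mem_filter] at hl ⊢
            refine ⟨hl.1, fun h0 => hl.2 ?_⟩
            exact le_antisymm ((hyx l hl.1).2 h0.le) ((hyx l hl.1).1 h0.ge)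
          · intro l hl
            have hmem : l y = 0 → l x = 0 := by
              intro h0
              by_contra hc
              have : l ∈ F.filter fun l => l x ≠ 0 := Finset.mem_filter.2 ⟨hl, hc⟩
              rw [← he, Finset.mem_filter] at this
              exact this.2 h0
            constructor
            · intro q
              by_contra hc
              have h3 := (hyx l hl).2 (not_le.1 hc).le
              linarith [hmem (le_antisymm h3 q)]
            · intro q
              by_contra hc
              have h3 := (hyx l hl).1 (not_le.1 hc).le
              linarith [hmem (le_antisymm q h3)]
        obtain ⟨s, hs, hys, hsy⟩ := ih _ (lt_of_lt_of_le hlt hn) y (hX x hx y hyx) le_rfl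
        have hrX : r x ∈ X := hX x hx _ (hr x).1
        have hrr : r (r x) = r x := hr' _ _ (hr x).1 (hr x).2
        have hzx : ∀ z ∈ s, Dom F z x := fun z hz => (hsy z hz).trans hyx
        refine ⟨insert (r x) s, ⟨Finset.insert_nonempty _ _, ?_, ?_⟩, ?_, ?_⟩
        · intro z hz
          rcases Finset.mem_insert.1 hz with rfl | hz
          · exact ⟨hrX, hrr⟩
          · exact hs.2.1 z hz
        · intro a ha c hc
          rcases Finset.mem_insert.1 ha with rfl | ha
          · rcases Finset.mem_insert.1 hc with rfl | hc
            · exact Or.inl (Dom.refl F _)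
            · exact Or.inr ((hzx c hc).trans (hr x).2)
          · rcases Finset.mem_insert.1 hc with rfl | hc
            · exact Or.inl ((hzx a ha).trans (hr x).2)
            · exact hs.2.2 a ha c hc
        · have ht0 : 0 < t := by linarith
          have hxe : x = (1 - t⁻¹) • r x + t⁻¹ • y := by
            rw [hy, smul_add, smul_smul, inv_mul_cancel₀ ht0.ne', one_smul, sub_smul, one_smul]
            abel
          have hmono : convexHull ℝ (s : Set E) ⊆ convexHull ℝ ((insert (r x) s : Finset E) : Set E) :=
            convexHull_mono (Finset.coe_subset.2 (Finset.subset_insert _ _))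
          have h1 : r x ∈ convexHull ℝ ((insert (r x) s : Finset E) : Set E) :=
            subset_convexHull ℝ _ (by simp)
          have h2 := convex_convexHull ℝ ((insert (r x) s : Finset E) : Set E) h1 (hmono hys)
            (sub_nonneg.2 (inv_le_one_of_one_le₀ ht)) (inv_nonneg.2 ht0.le) (by ring)
          rwa [← hxe] at h2
        · intro z hz
          rcases Finset.mem_insert.1 hz with rfl | hz
          · exact (hr x).1
          · exact hzx z hz
  let K : Geometry.SimplicialComplex ℝ E :=
    { faces := {s | face s}
      isRelLowerSet_faces := by
        intro s hs
        refine ⟨hs.1, fun t hts ht => ⟨ht, fun z hz => hs.2.1 z (hts hz), fun x hx y hy =>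
          hs.2.2 x (hts hx) y (hts hy)⟩⟩
      indep := by
        intro s hs
        refine indep_of_unique _ fun w v hw hv hw1 hv1 he => ?_
        have conv : ∀ u : s → ℝ, ∀ z : s,
            (fun z : E => if h : z ∈ s then u ⟨z, h⟩ else 0) z = u z := by
          intro u z; simp
        have hu := huniq s s hs hs (fun z => if h : z ∈ s then w ⟨z, h⟩ else 0)
          (fun z => if h : z ∈ s then v ⟨z, h⟩ else 0)
          (fun z hz => by simp [hz, hw]) (fun z hz => by simp [hz, hv])
          (by rw [← Finset.sum_coe_sort, ← hw1]; simp)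
          (by rw [← Finset.sum_coe_sort, ← hv1]; simp)
          (by
            rw [← Finset.sum_coe_sort s fun z => (if h : z ∈ s then w ⟨z, h⟩ else 0) • z,
              ← Finset.sum_coe_sort s fun z => (if h : z ∈ s then v ⟨z, h⟩ else 0) • z]
            simpa using he)
        funext z
        have := hu z.1 (by simp)
        simpa using this
      inter_subset_convexHull := by
        intro s t hs ht x hx
        obtain ⟨w, hw0, hw1, hwx⟩ := Finset.mem_convexHull'.1 hx.1
        obtain ⟨v, hv0, hv1, hvx⟩ := Finset.mem_convexHull'.1 hx.2
        have hu := huniq s t hs ht w v hw0 hv0 hw1 hv1 (hwx.trans hvx.symm)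
        have hz0 : ∀ z ∈ s, z ∉ s ∩ t → w z = 0 := by
          intro z hz hzt
          have := hu z (Finset.mem_union_left _ hz)
          rw [if_pos hz, if_neg (fun h => hzt (Finset.mem_inter.2 ⟨hz, h⟩))] at this
          exact this
        rw [← Finset.coe_inter, Finset.mem_convexHull']
        refine ⟨w, fun z hz => hw0 z (Finset.mem_inter.1 hz).1, ?_, ?_⟩
        · rw [Finset.sum_subset Finset.inter_subset_left hz0, hw1]
        · rw [Finset.sum_subset Finset.inter_subset_left fun z hz h => by
            rw [hz0 z hz h, zero_smul], hwx] }
  refine ⟨K, ?_, ?_, ?_⟩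
  · refine (Set.Finite.finite_subsets hrf).preimage (Finset.coe_injective.injOn) |>.subset ?_
    intro s hs z hz
    exact ⟨z, (hs.2.1 z hz).2⟩
  · ext x
    rw [Geometry.SimplicialComplex.mem_space_iff]
    constructor
    · rintro ⟨s, hs, hxs⟩
      obtain ⟨y, hy, hd⟩ := htop s hs
      exact hX y hy x (dom_of_mem_convexHull hd hxs)
    · intro hx
      obtain ⟨s, hs, hxs, -⟩ := hcover _ x hx le_rfl
      exact ⟨s, hs, hxs⟩
  · intro s hs
    obtain ⟨y, hy, hd⟩ := htop s hs
    exact ⟨y, hy, fun z hz => dom_of_mem_convexHull hd hz⟩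

/-- Barycentric coordinates of a simplex, extended to affine functions on the whole space. -/
theorem exists_coords [FiniteDimensional ℝ E] (t : Finset E)
    (ht : AffineIndependent ℝ (Subtype.val : t → E)) :
    ∃ (c : E → E →ᵃ[ℝ] ℝ) (T : Finset E), t ⊆ T ∧
      (∀ x, x ∈ convexHull ℝ (t : Set E) ↔ (∀ z ∈ t, 0 ≤ c z x) ∧ ∀ z ∈ T, z ∉ t → c z x = 0) ∧
      ∀ x ∈ convexHull ℝ (t : Set E), ∑ z ∈ t, c z x = 1 ∧ ∑ z ∈ t, c z x • z = x := by
  classical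
  obtain ⟨T', htT, hT, hspan⟩ :=
    exists_subset_affineIndependent_affineSpan_eq_top (k := ℝ) (s := (t : Set E)) ht
  have : Finite T' := finite_set_of_fin_dim_affineIndependent ℝ hT
  have hfin : T'.Finite := Set.toFinite T'
  obtain ⟨T, rfl⟩ := hfin.exists_finset_coe
  have hT2 : AffineIndependent ℝ (Subtype.val : T → E) :=
    hT
  let b : AffineBasis T ℝ E := ⟨Subtype.val, hT2, by simpa using hspan⟩
  let c : E → E →ᵃ[ℝ] ℝ := fun z => if h : z ∈ T then b.coord ⟨z, h⟩ else 0
  have hc : ∀ z : T, c z.1 = b.coord z := fun z => by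
    have : z.1 ∈ T := z.2
    simp [c, this]
  have hsum : ∀ x, ∑ z ∈ T, c z x = 1 := by
    intro x
    rw [← b.sum_coord_apply_eq_one x, ← Finset.sum_coe_sort]
    exact Finset.sum_congr rfl fun z _ => by rw [← hc]
  have hlin : ∀ x, ∑ z ∈ T, c z x • z = x := by
    intro x
    conv_rhs => rw [← b.linear_combination_coord_eq_self x]
    rw [← Finset.sum_coe_sort]
    exact Finset.sum_congr rfl fun z _ => by rw [← hc]; rfl
  have hcz : ∀ z ∈ T, ∀ y ∈ T, c z y = if z = y then 1 else 0 := by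
    intro z hz y hy
    have := b.coord_apply ⟨z, hz⟩ ⟨y, hy⟩
    rw [← hc] at this
    change c z y = _ at this
    simpa using this
  have htT' : t ⊆ T := Finset.coe_subset.1 htT
  have hred : ∀ x, (∀ z ∈ T, z ∉ t → c z x = 0) →
      ∑ z ∈ t, c z x = 1 ∧ ∑ z ∈ t, c z x • z = x := by
    intro x h
    constructor
    · rw [Finset.sum_subset htT' h, hsum]
    · rw [Finset.sum_subset htT' fun z hz hzt => by rw [h z hz hzt, zero_smul], hlin]
  have hiff : ∀ x, x ∈ convexHull ℝ (t : Set E) ↔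
      (∀ z ∈ t, 0 ≤ c z x) ∧ ∀ z ∈ T, z ∉ t → c z x = 0 := by
    intro x
    constructor
    · intro hx
      obtain ⟨w, hw0, hw1, rfl⟩ := Finset.mem_convexHull'.1 hx
      have hval : ∀ z ∈ T, c z (∑ y ∈ t, w y • y) = if z ∈ t then w z else 0 := by
        intro z hz
        rw [aff_sum (c z) t w (fun y => y) hw1]
        rw [Finset.sum_congr rfl fun y hy => by rw [hcz z hz y (htT' hy)]]
        simp
      refine ⟨fun z hz => ?_, fun z hz hzt => ?_⟩
      · rw [hval z (htT' hz), if_pos hz]; exact hw0 z hz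
      · rw [hval z hz, if_neg hzt]
    · rintro ⟨h0, h1⟩
      exact Finset.mem_convexHull'.2 ⟨fun z => c z x, h0, hred x h1⟩
  exact ⟨c, T, htT', hiff, fun x hx => hred x ((hiff x).1 hx).2⟩

/-- A simplex is a union of closed cells, for finitely many affine functions. -/
theorem exists_functions [FiniteDimensional ℝ E] (t : Finset E)
    (ht : AffineIndependent ℝ (Subtype.val : t → E)) :
    ∃ F : Finset (E →ᵃ[ℝ] ℝ), ∀ x ∈ convexHull ℝ (t : Set E), ∀ y, Dom F y x →
      y ∈ convexHull ℝ (t : Set E) := by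
  classical
  obtain ⟨c, T, htT, hiff, -⟩ := exists_coords t ht
  refine ⟨T.image c, fun x hx y hy => (hiff y).2 ?_⟩
  obtain ⟨h0, h1⟩ := (hiff x).1 hx
  refine ⟨fun z hz => (hy (c z) (Finset.mem_image_of_mem c (htT hz))).1 (h0 z hz),
    fun z hz hzt => ?_⟩
  have := hy (c z) (Finset.mem_image_of_mem c hz)
  exact le_antisymm (this.2 (h1 z hz hzt).le) (this.1 (h1 z hz hzt).ge)

/-- `f` is affine on the closed cells, for some choice of finitely many affine functions. -/
def CellAffine (X : Set E) (f : X ≃ₜ X) : Prop :=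
  ∃ (F : Finset (E →ᵃ[ℝ] ℝ)) (Q : Finset (E →ᵃ[ℝ] E)), ∀ x ∈ X, ∃ A ∈ Q, ∀ y, Dom F y x →
    ∃ hy : y ∈ X, (f ⟨y, hy⟩ : E) = A y

theorem CellAffine.isPL {X : Set E} (hXb : Bornology.IsBounded X) {f : X ≃ₜ X}
    (hf : CellAffine X f) : IsPL X f := by
  obtain ⟨F, Q, h⟩ := hf
  obtain ⟨K, hK, hKX, hKF⟩ := exists_triangulation F hXb fun x hx y hy => by
    obtain ⟨A, -, hA⟩ := h x hx
    exact (hA y hy).1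
  refine ⟨K, hK, hKX, fun s hs => ?_⟩
  obtain ⟨x, hx, hd⟩ := hKF s hs
  obtain ⟨A, -, hA⟩ := h x hx
  exact ⟨A, fun y hy => (hA y (hd y hy)).2⟩

theorem cellAffine_of_cover [FiniteDimensional ℝ E] {X : Set E} {f : X ≃ₜ X}
    (S : Set (Finset E)) (hS : S.Finite)
    (hind : ∀ s ∈ S, AffineIndependent ℝ (Subtype.val : s → E))
    (hcov : ∀ x ∈ X, ∃ s ∈ S, x ∈ convexHull ℝ (s : Set E))
    (hsub : ∀ s ∈ S, convexHull ℝ (s : Set E) ⊆ X)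
    (haff : ∀ s ∈ S, ∃ A : E →ᵃ[ℝ] E,
      ∀ x : X, (x : E) ∈ convexHull ℝ (s : Set E) → (f x : E) = A x) : CellAffine X f := by
  classical
  lift S to Finset (Finset E) using hS
  choose! F hF using fun s hs => exists_functions s (hind s hs)
  choose! A hA using haff
  refine ⟨S.biUnion F, S.image A, fun x hx => ?_⟩
  obtain ⟨s, hs, hxs⟩ := hcov x hx
  refine ⟨A s, Finset.mem_image_of_mem A hs, fun y hy => ?_⟩
  have hys := hF s hs x hxs y (hy.mono (Finset.subset_biUnion_of_mem F hs))
  exact ⟨hsub s hs hys, hA s hs ⟨y, hsub s hs hys⟩ hys⟩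

theorem IsPL.cellAffine [FiniteDimensional ℝ E] {X : Set E} {f : X ≃ₜ X} (hf : IsPL X f) :
    CellAffine X f := by
  obtain ⟨K, hK, hKX, h⟩ := hf
  refine cellAffine_of_cover K.faces hK (fun s hs => K.indep hs) (fun x hx => ?_) (fun s hs => ?_) h
  · rw [← hKX, Geometry.SimplicialComplex.mem_space_iff] at hx
    exact hx
  · rw [← hKX]; exact K.convexHull_subset_space hs

theorem IsPL.mul [FiniteDimensional ℝ E] {X : Set E} (hXb : Bornology.IsBounded X) {f g : X ≃ₜ X}
    (hf : IsPL X f) (hg : IsPL X g) : IsPL X (f * g) := by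
  classical
  obtain ⟨F, Q, hF⟩ := hf.cellAffine
  obtain ⟨G, R, hG⟩ := hg.cellAffine
  refine CellAffine.isPL hXb ⟨G ∪ R.biUnion fun B => F.image fun l => l.comp B,
    Q.biUnion fun A => R.image fun B => A.comp B, fun x hx => ?_⟩
  obtain ⟨B, hB, hBx⟩ := hG x hx
  obtain ⟨A, hA, hAx⟩ := hF (g ⟨x, hx⟩) (g ⟨x, hx⟩).2
  refine ⟨A.comp B, Finset.mem_biUnion.2 ⟨A, hA, Finset.mem_image.2 ⟨B, hB, rfl⟩⟩, fun y hy => ?_⟩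
  obtain ⟨hyX, hyB⟩ := hBx y (hy.mono Finset.subset_union_left)
  have hxB : (g ⟨x, hx⟩ : E) = B x := (hBx x (Dom.refl G x)).2
  have hd : Dom F (g ⟨y, hyX⟩ : E) (g ⟨x, hx⟩) := by
    rw [hyB, hxB]
    intro l hl
    exact hy (l.comp B) (Finset.mem_union_right _
      (Finset.mem_biUnion.2 ⟨B, hB, Finset.mem_image.2 ⟨l, hl, rfl⟩⟩))
  obtain ⟨h1, h2⟩ := hAx _ hd
  refine ⟨hyX, ?_⟩
  rw [AffineMap.comp_apply, ← hyB, ← h2]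
  rfl

theorem IsPL.inv [FiniteDimensional ℝ E] {X : Set E} (hXb : Bornology.IsBounded X) {f : X ≃ₜ X}
    (hf : IsPL X f) : IsPL X f⁻¹ := by
  classical
  obtain ⟨K, hK, hKX, h⟩ := hf
  choose! A hA using h
  have hsub : ∀ s ∈ K.faces, convexHull ℝ (s : Set E) ⊆ X := fun s hs => by
    rw [← hKX]; exact K.convexHull_subset_space hs
  have hinj : ∀ s ∈ K.faces, Set.InjOn (A s) (convexHull ℝ (s : Set E)) := by
    intro s hs x hx y hy hxy
    have h1 := hA s hs ⟨x, hsub s hs hx⟩ hx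
    have h2 := hA s hs ⟨y, hsub s hs hy⟩ hy
    have h3 : f ⟨x, hsub s hs hx⟩ = f ⟨y, hsub s hs hy⟩ :=
      Subtype.ext (h1.trans (hxy.trans h2.symm))
    exact congrArg Subtype.val (f.injective h3)
  have himg : ∀ s : Finset E,
      convexHull ℝ ((s.image (A s) : Finset E) : Set E) = A s '' convexHull ℝ (s : Set E) := by
    intro s
    rw [AffineMap.image_convexHull, Finset.coe_image]
  have hind : ∀ s ∈ K.faces,
      AffineIndependent ℝ (Subtype.val : (s.image (A s) : Finset E) → E) := by
    intro s hs
    have h1 : AffineIndependent ℝ (fun z : s => A s z.1) := by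
      refine indep_of_unique _ fun w v hw hv hw1 hv1 he => ?_
      rw [← aff_sum (A s) _ w (fun z : s => z.1) hw1,
        ← aff_sum (A s) _ v (fun z : s => z.1) hv1] at he
      have hmem : ∀ u : s → ℝ, (∀ i, 0 ≤ u i) → ∑ i, u i = 1 →
          ∑ z, u z • z.1 ∈ convexHull ℝ (s : Set E) := fun u hu hu1 =>
        (convex_convexHull ℝ _).sum_mem (fun i _ => hu i) hu1
          fun i _ => subset_convexHull ℝ _ i.2
      have he' := hinj s hs (hmem w hw hw1) (hmem v hv hv1) he
      have h0 := affineIndependent_iff.1 (K.indep hs) Finset.univ (w - v)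
        (by simp only [Pi.sub_apply, Finset.sum_sub_distrib, hw1, hv1, sub_self])
        (by simp only [Pi.sub_apply, sub_smul, Finset.sum_sub_distrib, he', sub_self])
      funext z
      have := h0 z (Finset.mem_univ z)
      simpa [sub_eq_zero] using this
    have h2 := h1.range
    have h3 : (Set.range fun z : s => A s z.1) = ((s.image (A s) : Finset E) : Set E) := by
      ext; simp
    rw [h3] at h2
    exact h2
  refine CellAffine.isPL hXb (cellAffine_of_cover ((fun s => s.image (A s)) '' K.faces)
    (hK.image _) ?_ ?_ ?_ ?_)
  · rintro _ ⟨s, hs, rfl⟩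
    exact hind s hs
  · intro x hx
    have : ((f⁻¹ ⟨x, hx⟩ : X) : E) ∈ K.space := by rw [hKX]; exact (f⁻¹ ⟨x, hx⟩ : X).2
    obtain ⟨s, hs, hxs⟩ := Geometry.SimplicialComplex.mem_space_iff.1 this
    refine ⟨_, ⟨s, hs, rfl⟩, ?_⟩
    dsimp only
    rw [himg]
    refine ⟨_, hxs, ?_⟩
    rw [← hA s hs _ hxs]
    simp
  · rintro _ ⟨s, hs, rfl⟩
    dsimp only
    rw [himg]
    rintro _ ⟨x, hx, rfl⟩
    rw [← hA s hs ⟨x, hsub s hs hx⟩ hx]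
    exact Subtype.coe_prop _
  · rintro _ ⟨s, hs, rfl⟩
    obtain ⟨c, T, -, hiff, hc⟩ := exists_coords _ (hind s hs)
    have hpre : ∀ z ∈ s.image (A s), ∃ u ∈ s, A s u = z := fun z hz => Finset.mem_image.1 hz
    choose! u hu hAu using hpre
    refine ⟨∑ z ∈ s.image (A s), ((LinearMap.toSpanSingleton ℝ E (u z)).toAffineMap.comp (c z)),
      fun x hx => ?_⟩
    obtain ⟨hc1, hc2⟩ := hc x hx
    have hc0 := ((hiff x).1 hx).1
    have hval : (∑ z ∈ s.image (A s),
        ((LinearMap.toSpanSingleton ℝ E (u z)).toAffineMap.comp (c z))) (x : E) =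
          ∑ z ∈ s.image (A s), c z x • u z := by
      generalize s.image (A s) = t
      induction t using Finset.induction_on with
      | empty => simp
      | insert a t ha ih => simp [Finset.sum_insert ha, ih]
    rw [hval]
    have hmem : ∑ z ∈ s.image (A s), c z x • u z ∈ convexHull ℝ (s : Set E) :=
      (convex_convexHull ℝ _).sum_mem hc0 hc1 fun z hz => subset_convexHull ℝ _ (hu z hz)
    have h1 := hA s hs ⟨_, hsub s hs hmem⟩ hmem
    have h3 : ∑ z ∈ s.image (A s), c z x • A s (u z) = x :=
      (Finset.sum_congr rfl fun z hz => by rw [hAu z hz]).trans hc2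
    have h2 : f ⟨_, hsub s hs hmem⟩ = x :=
      Subtype.ext (h1.trans ((aff_sum (A s) _ _ _ hc1).trans h3))
    have h4 : f⁻¹ x = ⟨_, hsub s hs hmem⟩ := by
      rw [Homeomorph.inv_apply, Homeomorph.symm_apply_eq]
      exact h2.symm
    rw [h4]

end General

/-- The square `I²`, where `I = [0, 1]`. -/
def square : Set (ℝ × ℝ) := Set.Icc 0 1 ×ˢ Set.Icc 0 1

theorem isBounded_square : Bornology.IsBounded square :=
  (Metric.isBounded_Icc 0 1).prod (Metric.isBounded_Icc 0 1)

theorem isPL_one : IsPL square (1 : square ≃ₜ square) := by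
  classical
  let a : ℝ × ℝ →ᵃ[ℝ] ℝ := (LinearMap.fst ℝ ℝ ℝ).toAffineMap
  let b : ℝ × ℝ →ᵃ[ℝ] ℝ := (LinearMap.snd ℝ ℝ ℝ).toAffineMap
  let k : ℝ × ℝ →ᵃ[ℝ] ℝ := AffineMap.const ℝ _ 1
  refine CellAffine.isPL isBounded_square ⟨{a, b, k - a, k - b}, {AffineMap.id ℝ _},
    fun x hx => ⟨_, Finset.mem_singleton_self _, fun y hy => ⟨?_, rfl⟩⟩⟩
  have h1 := hy a (by simp)
  have h2 := hy b (by simp)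
  have h3 := hy (k - a) (by simp)
  have h4 := hy (k - b) (by simp)
  simp only [a, b, k, AffineMap.coe_sub, Pi.sub_apply, AffineMap.const_apply,
    LinearMap.coe_toAffineMap, LinearMap.fst_apply, LinearMap.snd_apply, sub_nonneg] at h1 h2 h3 h4
  obtain ⟨⟨p1, p2⟩, p3, p4⟩ := hx
  exact ⟨⟨h1.1 p1, h3.1 p2⟩, h2.1 p3, h4.1 p4⟩

/-- The group `PL(I², ∂I²)` of piecewise linear homeomorphisms of the square that fix its boundary
pointwise, under composition. -/
def PLSquare : Subgroup (square ≃ₜ square) where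
  carrier := {f | IsPL square f ∧ ∀ x : square, (x : ℝ × ℝ) ∈ frontier square → f x = x}
  one_mem' := ⟨isPL_one, fun _ _ => rfl⟩
  mul_mem' := by
    intro f g hf hg
    refine ⟨hf.1.mul isBounded_square hg.1, fun x hx => ?_⟩
    rw [Homeomorph.mul_apply, hg.2 x hx, hf.2 x hx]
  inv_mem' := by
    intro f hf
    refine ⟨hf.1.inv isBounded_square, fun x hx => ?_⟩
    rw [Homeomorph.inv_apply, Homeomorph.symm_apply_eq, hf.2 x hx]

/-- A group is indicable if it admits a surjective homomorphism onto the integers. -/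
def Indicable (G : Type*) [Group G] : Prop :=
  ∃ φ : G →* Multiplicative ℤ, Function.Surjective φ

/-- A group is locally indicable if each nontrivial finitely generated subgroup is indicable. -/
def LocallyIndicable (G : Type*) [Group G] : Prop :=
  ∀ H : Subgroup G, H ≠ ⊥ → H.FG → Indicable H

/-- A group is left-orderable if it has a strict total order invariant under left
multiplication. -/
def LeftOrderable (G : Type*) [Group G] : Prop :=
  ∃ lt : G → G → Prop, IsStrictTotalOrder G lt ∧ ∀ f g h : G, lt g h → lt (f * g) (f * h)

end PLHomeo

/-!
The group is locally indicable because, at a suitable common fixed point, a finitely generated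
subgroup has a nontrivial group of germs inside the affine group of the line.

Extend the homeomorphisms by the identity to the plane, and let `S` generate the subgroup. There is
a finite arrangement of lines such that each generator is affine on every closed cell and its fixed
points form a union of closed cells (`exists_cellAffinePerm_extendPlane`). Follow a line in general
direction from infinity, where all generators are trivial, towards a moved point `q`, and let `p` be
the first point beyond which some generator is nontrivial. As the direction is general, `p` is not a
crossing of two lines of the arrangement, so near `p` there are just two sides, on each of which the
generators are affine. They are the identity on the near side, and injectivity forces them to
preserve the far one (`exists_shearGerm`). There they have the form
`(u, t) ↦ (u + a * t, b * t)` with `b > 0`. No argument about orientation is needed, since one side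
of `p` is fixed pointwise. Such germs compose like affine maps of the line; so `log b` is a
homomorphism to `ℝ`, and if it is trivial then `a` is one (`indicable_of_shearGerm`). One of the two
is nontrivial because some generator moves points just beyond `p`. The image in `ℝ` is a nonzero
finitely generated torsion-free abelian group, hence maps onto `ℤ` (`indicable_of_monoidHom`).

Left-orderability is the theorem of Burns and Hale (`LocallyIndicable.leftOrderable`): maps onto `ℤ`
give, by induction, positive cones for finite sets of elements, and an ultrafilter glues them.
-/

namespace PLHomeo

open Filter Topology

/-! ### Local indicability and left orders -/

theorem indicable_of_monoidHom {G : Type*} [Group G] [Group.FG G] {A : Type*} [AddCommGroup A]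
    [Module.IsTorsionFree ℤ A] (φ : G →* Multiplicative A) (hφ : φ ≠ 1) : Indicable G := by
  -- the image is a nonzero finitely generated free abelian group; project to a coordinate
  let R : AddSubgroup A := φ.range.toAddSubgroup'
  have hR : ∀ x, x ∈ R ↔ ∃ g, (φ g).toAdd = x := fun x => Iff.rfl
  let ψ : G →* Multiplicative R :=
    { toFun := fun g => Multiplicative.ofAdd ⟨(φ g).toAdd, (hR _).2 ⟨g, rfl⟩⟩
      map_one' := by
        rw [← ofAdd_zero]
        congr 1
        ext
        simp
      map_mul' := fun g h => by
        rw [← ofAdd_add]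
        congr 1
        ext
        simp }
  have hψ : Function.Surjective ψ := by
    intro x
    obtain ⟨g, hg⟩ := (hR _).1 x.toAdd.2
    exact ⟨g, congrArg Multiplicative.ofAdd (Subtype.ext hg)⟩
  have hfg : Group.FG (Multiplicative R) := Group.fg_of_surjective hψ
  have hfg' : AddGroup.FG R := AddGroup.fg_iff_mul_fg.2 hfg
  have hfin : Module.Finite ℤ R := Module.Finite.iff_addGroup_fg.2 hfg'
  have htf : Module.IsTorsionFree ℤ R :=
    Function.Injective.moduleIsTorsionFree (Subtype.val : R → A) Subtype.val_injective
      fun _ _ => rfl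
  let b := Module.Free.chooseBasis ℤ R
  have hne : Nonempty (Module.Free.ChooseBasisIndex ℤ R) := by
    by_contra hc
    rw [not_nonempty_iff] at hc
    have : Subsingleton R := b.repr.toEquiv.subsingleton
    refine hφ (MonoidHom.ext fun g => ?_)
    have := congrArg Subtype.val (Subsingleton.elim (ψ g).toAdd 0)
    exact congrArg Multiplicative.ofAdd this
  obtain ⟨i⟩ := hne
  refine ⟨(AddMonoidHom.toMultiplicative (b.coord i).toAddMonoidHom).comp ψ, fun n => ?_⟩
  obtain ⟨g, hg⟩ := hψ (Multiplicative.ofAdd (n.toAdd • b i))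
  refine ⟨g, ?_⟩
  rw [MonoidHom.comp_apply, hg]
  apply Multiplicative.toAdd.injective
  simp

/-- In a locally indicable group, finitely many nontrivial elements can be given signs so that
no product of the signed elements is trivial. Induction on the number of elements: a map to `ℤ` that
does not kill all of them decides some of the signs, and is zero on the remaining ones. -/
theorem LocallyIndicable.exists_mul_closed {G : Type*} [Group G] (hG : LocallyIndicable G) :
    ∀ (n : ℕ) (T : Finset G), T.card = n → 1 ∉ T →
      ∃ P : Set G, 1 ∉ P ∧ (∀ g ∈ P, ∀ h ∈ P, g * h ∈ P) ∧ ∀ g ∈ T, g ∈ P ∨ g⁻¹ ∈ P := by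
  classical
  intro n
  induction n using Nat.strong_induction_on with
  | _ n ih =>
    intro T hn h1
    rcases T.eq_empty_or_nonempty with rfl | ⟨g₀, hg₀⟩
    · exact ⟨∅, by simp, by simp, by simp⟩
    let H : Subgroup G := Subgroup.closure (T : Set G)
    have hTH : ∀ g ∈ T, g ∈ H := fun g hg => Subgroup.subset_closure hg
    have hne : H ≠ ⊥ := fun h => h1 <| by
      have := hTH g₀ hg₀
      rw [h, Subgroup.mem_bot] at this
      exact this ▸ hg₀
    obtain ⟨φ, hφ⟩ := hG H hne ⟨T, rfl⟩
    let T₀ := T.filter fun g => ∀ hg : g ∈ H, φ ⟨g, hg⟩ = 1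
    have hlt : T₀.card < T.card := by
      refine Finset.card_lt_card (Finset.filter_ssubset.2 ?_)
      by_contra hc
      push Not at hc
      -- otherwise the map vanishes on generators
      have hall : ∀ x : H, φ x = 1 := by
        rintro ⟨x, hx⟩
        induction hx using Subgroup.closure_induction with
        | mem x hx => exact hc x hx _
        | one => exact map_one φ
        | mul x y hx hy ihx ihy =>
          exact (map_mul φ ⟨x, hx⟩ ⟨y, hy⟩).trans (by rw [ihx, ihy, one_mul])
        | inv x hx ihx => exact (map_inv φ ⟨x, hx⟩).trans (by rw [ihx, inv_one])
      obtain ⟨x, hx⟩ := hφ (Multiplicative.ofAdd 1)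
      rw [hall x] at hx
      exact absurd hx (by decide)
    obtain ⟨P, hP1, hPm, hPT⟩ := ih _ (hn ▸ hlt) T₀ rfl fun h => h1 (Finset.mem_filter.1 h).1
    refine ⟨{g | ∃ hg : g ∈ H, 1 < φ ⟨g, hg⟩ ∨ φ ⟨g, hg⟩ = 1 ∧ g ∈ P}, ?_, ?_, ?_⟩
    · rintro ⟨hg, h | h⟩
      · exact h.ne (map_one φ).symm
      · exact hP1 h.2
    · rintro g ⟨hg, hg'⟩ h ⟨hh, hh'⟩
      refine ⟨H.mul_mem hg hh, ?_⟩
      have hm : φ ⟨g * h, H.mul_mem hg hh⟩ = φ ⟨g, hg⟩ * φ ⟨h, hh⟩ := map_mul φ ⟨g, hg⟩ ⟨h, hh⟩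
      rw [hm]
      rcases hg' with a | ⟨a, a'⟩ <;> rcases hh' with b | ⟨b, b'⟩
      · exact Or.inl (one_lt_mul'' a b)
      · exact Or.inl (by rwa [b, mul_one])
      · exact Or.inl (by rwa [a, one_mul])
      · exact Or.inr ⟨by rw [a, b, one_mul], hPm g a' h b'⟩
    · intro g hg
      have hi : φ ⟨g⁻¹, H.inv_mem (hTH g hg)⟩ = (φ ⟨g, hTH g hg⟩)⁻¹ := map_inv φ ⟨g, hTH g hg⟩
      rcases lt_trichotomy 1 (φ ⟨g, hTH g hg⟩) with h | h | h
      · exact Or.inl ⟨hTH g hg, Or.inl h⟩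
      · rcases hPT g (Finset.mem_filter.2 ⟨hg, fun _ => h.symm⟩) with q | q
        · exact Or.inl ⟨hTH g hg, Or.inr ⟨h.symm, q⟩⟩
        · exact Or.inr ⟨H.inv_mem (hTH g hg), Or.inr ⟨by rw [hi, ← h, inv_one], q⟩⟩
      · exact Or.inr ⟨H.inv_mem (hTH g hg), Or.inl (by rw [hi]; exact one_lt_inv'.2 h)⟩

/-- Locally indicable groups are left-orderable (Burns–Hale). The partial positive cones for the
finite subsets of `G` have a limit along an ultrafilter, and this limit is a positive cone. -/
theorem LocallyIndicable.leftOrderable {G : Type*} [Group G] (hG : LocallyIndicable G) :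
    LeftOrderable G := by
  classical
  choose P hP1 hPm hPT using fun T : Finset G =>
    hG.exists_mul_closed _ (T.erase 1) rfl (Finset.notMem_erase 1 T)
  let U : Ultrafilter (Finset G) := Ultrafilter.of Filter.atTop
  let C : Set G := {g | ∀ᶠ T in (U : Filter (Finset G)), g ∈ P T}
  have hC1 : (1 : G) ∉ C := fun h => by
    obtain ⟨T, hT⟩ := Filter.Eventually.exists h
    exact hP1 T hT
  have hCm : ∀ g ∈ C, ∀ h ∈ C, g * h ∈ C := fun g hg h hh => by
    filter_upwards [hg, hh] with T a b using hPm T g a h b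
  have hCT : ∀ g, g ≠ 1 → g ∈ C ∨ g⁻¹ ∈ C := fun g hg => by
    refine Ultrafilter.eventually_or.1 ?_
    filter_upwards [Ultrafilter.of_le (f := Filter.atTop)
      (Filter.eventually_ge_atTop ({g} : Finset G))] with T hT
    exact hPT T g (Finset.mem_erase.2 ⟨hg, hT (Finset.mem_singleton_self g)⟩)
  refine ⟨fun g h => g⁻¹ * h ∈ C, ?_, fun f g h hgh => ?_⟩
  · refine { trichotomous := fun g h hgh hhg => ?_, irrefl := fun g hg => ?_,
             trans := fun a b c hab hbc => ?_ }
    · by_contra hne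
      rcases hCT (g⁻¹ * h) fun q => hne (inv_mul_eq_one.1 q) with q | q
      · exact hgh q
      · exact hhg (by simpa using q)
    · exact hC1 (by simpa using hg)
    · simpa [mul_assoc] using hCm _ hab _ hbc
  · simpa [mul_assoc] using hgh

/-! ### Germs of shears along a fixed segment -/

/-- The linear map of the plane that fixes the first axis pointwise and sends `(0, 1)` to `(a, b)`. -/
def shear (a b : ℝ) (x : ℝ × ℝ) : ℝ × ℝ := (x.1 + a * x.2, b * x.2)

/-- The filter of neighbourhoods of the origin in the closed upper half-plane. -/
def halfNhds : Filter (ℝ × ℝ) := 𝓝[{x | 0 ≤ x.2}] 0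

theorem tendsto_shear {a b : ℝ} (hb : 0 < b) : Tendsto (shear a b) halfNhds halfNhds := by
  refine tendsto_nhdsWithin_iff.2 ⟨?_, ?_⟩
  · have h : Continuous (shear a b) := by unfold shear; fun_prop
    have h0 : shear a b 0 = 0 := by simp [shear]
    exact (h0 ▸ h.tendsto 0).mono_left nhdsWithin_le_nhds
  · filter_upwards [self_mem_nhdsWithin] with x hx
    exact mul_nonneg hb.le hx

variable {α : Type*} {P : ℝ × ℝ → α}

/-- In the coordinates `P`, the permutation `f` is the map `shear a b` near the origin in the closed
upper half-plane, and it preserves this half-plane. -/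
def ShearGerm (P : ℝ × ℝ → α) (f : Equiv.Perm α) (a b : ℝ) : Prop :=
  0 < b ∧ ∀ᶠ x in halfNhds, f (P x) = P (shear a b x)

theorem ShearGerm.one (P : ℝ × ℝ → α) : ShearGerm P 1 0 1 :=
  ⟨one_pos, .of_forall fun x => by simp [shear]⟩

theorem ShearGerm.mul {f g : Equiv.Perm α} {a b c d : ℝ} (hf : ShearGerm P f a b)
    (hg : ShearGerm P g c d) : ShearGerm P (f * g) (c + a * d) (b * d) := by
  refine ⟨mul_pos hf.1 hg.1, ?_⟩
  filter_upwards [hg.2, (tendsto_shear hg.1).eventually hf.2] with x h1 h2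
  rw [Equiv.Perm.mul_apply, h1, h2]
  congr 1
  ext <;> simp only [shear] <;> ring

theorem ShearGerm.inv {f : Equiv.Perm α} {a b : ℝ} (hf : ShearGerm P f a b) :
    ShearGerm P f⁻¹ (-(a / b)) b⁻¹ := by
  have hb := hf.1.ne'
  refine ⟨inv_pos.2 hf.1, ?_⟩
  filter_upwards [(tendsto_shear (a := -(a / b)) (inv_pos.2 hf.1)).eventually hf.2] with x hx
  rw [Equiv.Perm.inv_eq_iff_eq, hx]
  congr 1
  ext <;> simp only [shear] <;> field_simp
  ring

theorem tendsto_vertical : Tendsto (fun t : ℝ => ((0, t) : ℝ × ℝ)) (𝓝[>] 0) halfNhds := by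
  refine tendsto_nhdsWithin_iff.2 ⟨?_, ?_⟩
  · have h : Continuous fun t : ℝ => ((0, t) : ℝ × ℝ) := by fun_prop
    exact (h.tendsto 0).mono_left nhdsWithin_le_nhds
  · filter_upwards [self_mem_nhdsWithin] with t ht
    exact (Set.mem_Ioi.1 ht).le

theorem ShearGerm.unique (hP : Function.Injective P) {f : Equiv.Perm α} {a b c d : ℝ}
    (h : ShearGerm P f a b) (h' : ShearGerm P f c d) : a = c ∧ b = d := by
  obtain ⟨t, ⟨h1, h2⟩, ht⟩ := ((tendsto_vertical.eventually (h.2.and h'.2)).and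
    self_mem_nhdsWithin).exists
  have ht0 : t ≠ 0 := (Set.mem_Ioi.1 ht).ne'
  have h3 := hP (h1.symm.trans h2)
  simp only [shear, zero_add, Prod.mk.injEq] at h3
  exact ⟨mul_right_cancel₀ ht0 h3.1, mul_right_cancel₀ ht0 h3.2⟩

/-- A finitely generated group of permutations whose generators have germs that are shears, not all
trivial, is indicable: the germs form a subgroup of the group of affine maps of the line, in which
one first looks at the dilation factors and, if they are all `1`, at the translation parts. -/
theorem indicable_of_shearGerm (hP : Function.Injective P) {G : Type*} [Group G]
    (ψ : G →* Equiv.Perm α) (S : Finset G) (hS : Subgroup.closure (S : Set G) = ⊤)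
    (hgen : ∀ s ∈ S, ∃ a b, ShearGerm P (ψ s) a b)
    (hne : ∃ s ∈ S, ¬ ShearGerm P (ψ s) 0 1) : Indicable G := by
  have hfg : Group.FG G := ⟨⟨S, hS⟩⟩
  have hall : ∀ g, ∃ a b, ShearGerm P (ψ g) a b := by
    intro g
    have hg : g ∈ Subgroup.closure (S : Set G) := hS ▸ Subgroup.mem_top g
    induction hg using Subgroup.closure_induction with
    | mem x hx => exact hgen x hx
    | one => exact ⟨0, 1, by rw [map_one]; exact .one P⟩
    | mul x y _ _ hx hy =>
      obtain ⟨a, b, hx⟩ := hx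
      obtain ⟨c, d, hy⟩ := hy
      exact ⟨_, _, by rw [map_mul]; exact hx.mul hy⟩
    | inv x _ hx =>
      obtain ⟨a, b, hx⟩ := hx
      exact ⟨_, _, by rw [map_inv]; exact hx.inv⟩
  choose a b hab using hall
  have hmul : ∀ g h, a (g * h) = a h + a g * b h ∧ b (g * h) = b g * b h := fun g h =>
    (hab (g * h)).unique hP (by rw [map_mul]; exact (hab g).mul (hab h))
  by_cases hb : ∀ g, b g = 1
  · let φ : G →* Multiplicative ℝ := MonoidHom.mk' (fun g => Multiplicative.ofAdd (a g))
      fun g h => by rw [(hmul g h).1, hb h, mul_one, add_comm]; rfl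
    refine indicable_of_monoidHom φ fun h => ?_
    obtain ⟨s, -, hs⟩ := hne
    have ha : a s = 0 := congrArg Multiplicative.toAdd (DFunLike.congr_fun h s)
    have := hab s
    rw [ha, hb s] at this
    exact hs this
  · let φ : G →* Multiplicative ℝ := MonoidHom.mk' (fun g => Multiplicative.ofAdd (Real.log (b g)))
      fun g h => by rw [(hmul g h).2, Real.log_mul (hab g).1.ne' (hab h).1.ne']; rfl
    refine indicable_of_monoidHom φ fun h => hb fun g => ?_
    have hl : Real.log (b g) = 0 := congrArg Multiplicative.toAdd (DFunLike.congr_fun h g)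
    exact Real.eq_one_of_pos_of_log_eq_zero (hab g).1 hl

/-! ### Cellwise affine permutations of the plane -/

/-- The permutation `f` of `E` is affine on each closed cell of the decomposition given by `F`, and
its fixed point set is a union of closed cells. -/
def CellAffinePerm {E : Type*} [NormedAddCommGroup E] [NormedSpace ℝ E] (F : Finset (E →ᵃ[ℝ] ℝ))
    (f : Equiv.Perm E) : Prop :=
  ∀ x, (∃ A : E →ᵃ[ℝ] E, ∀ y, Dom F y x → f y = A y) ∧ (f x = x → ∀ y, Dom F y x → f y = y)

theorem CellAffinePerm.mono {E : Type*} [NormedAddCommGroup E] [NormedSpace ℝ E]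
    {F G : Finset (E →ᵃ[ℝ] ℝ)} {f : Equiv.Perm E} (hf : CellAffinePerm F f) (h : F ⊆ G) :
    CellAffinePerm G f := fun x =>
  ⟨(hf x).1.imp fun _ hA y hy => hA y (hy.mono h), fun hx y hy => (hf x).2 hx y (hy.mono h)⟩

/-- Every point lies in the closure of the cells of the nearby points. -/
theorem eventually_dom {E : Type*} [NormedAddCommGroup E] [NormedSpace ℝ E] [FiniteDimensional ℝ E]
    (F : Finset (E →ᵃ[ℝ] ℝ)) (p : E) : ∀ᶠ y in 𝓝 p, Dom F p y := by
  have h : ∀ l ∈ F, ∀ᶠ y in 𝓝 p, (0 ≤ l y → 0 ≤ l p) ∧ (l y ≤ 0 → l p ≤ 0) := by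
    intro l _
    have hc : Tendsto l (𝓝 p) (𝓝 (l p)) := (AffineMap.continuous_of_finiteDimensional l).tendsto p
    rcases lt_trichotomy (l p) 0 with h | h | h
    · filter_upwards [hc.eventually (gt_mem_nhds h)] with y hy
      exact ⟨fun q => absurd hy q.not_gt, fun _ => h.le⟩
    · exact .of_forall fun y => ⟨fun _ => h.ge, fun _ => h.le⟩
    · filter_upwards [hc.eventually (lt_mem_nhds h)] with y hy
      exact ⟨fun _ => h.le, fun q => absurd hy q.not_gt⟩
  exact (Filter.eventually_all_finset F).2 h

/-- Linear coordinates whose first axis is the kernel of `lam` and whose second axis is the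
transverse direction `w`. -/
theorem exists_chart (lam : ℝ × ℝ →ₗ[ℝ] ℝ) (w : ℝ × ℝ) (hw : lam w ≠ 0) :
    ∃ e : (ℝ × ℝ) ≃ₗ[ℝ] ℝ × ℝ, e (0, 1) = w ∧ lam (e (1, 0)) = 0 := by
  let v : ℝ × ℝ := (-lam (0, 1), lam (1, 0))
  have hlam : ∀ x : ℝ × ℝ, lam x = x.1 * lam (1, 0) + x.2 * lam (0, 1) := by
    intro x
    conv_lhs => rw [show x = x.1 • ((1, 0) : ℝ × ℝ) + x.2 • ((0, 1) : ℝ × ℝ) by ext <;> simp]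
    rw [map_add, map_smul, map_smul, smul_eq_mul, smul_eq_mul]
  have hv : lam v = 0 := by rw [hlam]; simp only [v]; ring
  have hv0 : v ≠ 0 := fun h => hw <| by
    have h1 : lam (0, 1) = 0 := by simpa [v] using congrArg Prod.fst h
    have h2 : lam (1, 0) = 0 := by simpa [v] using congrArg Prod.snd h
    rw [hlam, h1, h2, mul_zero, mul_zero, add_zero]
  let M : ℝ × ℝ →ₗ[ℝ] ℝ × ℝ :=
    (LinearMap.fst ℝ ℝ ℝ).smulRight v + (LinearMap.snd ℝ ℝ ℝ).smulRight w
  have hM : ∀ x, M x = x.1 • v + x.2 • w := fun x => rfl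
  have hinj : Function.Injective M := by
    refine (injective_iff_map_eq_zero M).2 fun x hx => ?_
    rw [hM] at hx
    have h2 : x.2 = 0 := by
      have := congrArg lam hx
      rw [map_add, map_smul, map_smul, hv, smul_zero, zero_add, map_zero, smul_eq_mul] at this
      exact (mul_eq_zero.1 this).resolve_right hw
    rw [h2, zero_smul, add_zero] at hx
    exact Prod.ext ((smul_eq_zero.1 hx).resolve_right hv0) h2
  refine ⟨LinearEquiv.ofInjectiveEndo M hinj, ?_, ?_⟩
  · simp [hM]
  · simp [hM, hv]

section Chart

variable {F : Finset (ℝ × ℝ →ᵃ[ℝ] ℝ)} {p : ℝ × ℝ} {e : (ℝ × ℝ) ≃ₗ[ℝ] ℝ × ℝ}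

/-- Suppose that all the lines of the arrangement through `p` coincide with the first axis of the
chart `e`. Then, near `p`, each open half-disc lies in a single cell, whose closure contains the
closed half-disc. -/
theorem exists_nhds_dom (he : ∀ l ∈ F, l p = 0 → l.linear (e (1, 0)) = 0) :
    ∃ N ∈ 𝓝 (0 : ℝ × ℝ), ∀ x ∈ N, ∀ y ∈ N, (0 < y.2 ∧ 0 ≤ x.2 ∨ y.2 < 0 ∧ x.2 ≤ 0) →
      Dom F (p + e x) (p + e y) := by
  have hc : Continuous fun x => p + e x :=
    continuous_const.add (LinearMap.continuous_of_finiteDimensional e.toLinearMap)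
  have hlp : ∀ (l : ℝ × ℝ →ᵃ[ℝ] ℝ) (x : ℝ × ℝ), l (p + e x) = l.linear (e x) + l p := by
    intro l x
    rw [add_comm p]
    exact l.map_vadd p (e x)
  refine ⟨{x | ∀ l ∈ F, l p ≠ 0 → 0 < l (p + e x) * l p}, ?_, fun x hx y hy hxy l hl => ?_⟩
  · refine (Filter.eventually_all_finset F).2 fun l _ => ?_
    by_cases h0 : l p = 0
    · exact .of_forall fun x h => absurd h0 h
    have hcl : Continuous fun x => l (p + e x) * l p :=
      ((AffineMap.continuous_of_finiteDimensional l).comp hc).mul continuous_const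
    have : 0 < l (p + e 0) * l p := by
      rw [map_zero, add_zero]
      exact mul_self_pos.2 h0
    filter_upwards [(hcl.tendsto 0).eventually (lt_mem_nhds this)] with x hx _ using hx
  · by_cases h0 : l p = 0
    · have hval : ∀ z : ℝ × ℝ, l (p + e z) = z.2 * l.linear (e (0, 1)) := by
        intro z
        rw [hlp, h0, add_zero]
        conv_lhs => rw [show z = z.1 • ((1, 0) : ℝ × ℝ) + z.2 • ((0, 1) : ℝ × ℝ) by ext <;> simp]
        rw [map_add, map_smul, map_smul, map_add, map_smul, map_smul, he l hl h0, smul_zero,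
          zero_add, smul_eq_mul]
      rw [hval, hval]
      rcases hxy with ⟨h1, h2⟩ | ⟨h1, h2⟩
      · exact ⟨fun q => mul_nonneg h2 (nonneg_of_mul_nonneg_right q h1),
          fun q => mul_nonpos_of_nonneg_of_nonpos h2 (nonpos_of_mul_nonpos_right q h1)⟩
      · exact ⟨fun q => mul_nonneg_of_nonpos_of_nonpos h2 (nonpos_of_mul_nonneg_right q h1),
          fun q => mul_nonpos_of_nonpos_of_nonneg h2 (by nlinarith)⟩
    · have h1 := hx l hl h0
      have h2 := hy l hl h0
      rcases lt_or_gt_of_ne h0 with h | h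
      · have h1' := neg_of_mul_pos_left h1 h.le
        have h2' := neg_of_mul_pos_left h2 h.le
        exact ⟨fun q => absurd h2' q.not_gt, fun _ => h1'.le⟩
      · have h1' := pos_of_mul_pos_left h1 h.le
        have h2' := pos_of_mul_pos_left h2 h.le
        exact ⟨fun _ => h1'.le, fun q => absurd h2' q.not_gt⟩

/-- If `f` fixes points on the lower side of the line through `p`, then it fixes that whole side
near `p`. It is then affine on the upper side, and injectivity prevents it from folding the upper
side over the lower one. -/
theorem exists_shearGerm (he : ∀ l ∈ F, l p = 0 → l.linear (e (1, 0)) = 0)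
    {f : Equiv.Perm (ℝ × ℝ)} (hf : CellAffinePerm F f)
    (hfix : ∀ t < 0, f (p + e (0, t)) = p + e (0, t)) :
    ∃ a b, ShearGerm (fun x => p + e x) f a b := by
  obtain ⟨N, hN, hdom⟩ := exists_nhds_dom he
  have hN0 : (0 : ℝ × ℝ) ∈ N := mem_of_mem_nhds hN
  have hvert : ∀ᶠ t : ℝ in 𝓝 0, ((0, t) : ℝ × ℝ) ∈ N := by
    have h : Continuous fun t : ℝ => ((0, t) : ℝ × ℝ) := by fun_prop
    exact h.tendsto 0 hN
  have hhor : ∀ᶠ t : ℝ in 𝓝 0, ((t, 0) : ℝ × ℝ) ∈ N := by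
    have h : Continuous fun t : ℝ => ((t, 0) : ℝ × ℝ) := by fun_prop
    exact h.tendsto 0 hN
  obtain ⟨r, hrN, hr⟩ := ((hvert.filter_mono nhdsWithin_le_nhds).and
    (self_mem_nhdsWithin (s := Set.Iio (0 : ℝ)))).exists
  obtain ⟨t, htN, ht⟩ := ((hvert.filter_mono nhdsWithin_le_nhds).and
    (self_mem_nhdsWithin (s := Set.Ioi (0 : ℝ)))).exists
  obtain ⟨u, huN, hu⟩ := ((hhor.filter_mono nhdsWithin_le_nhds).and
    (self_mem_nhdsWithin (s := Set.Ioi (0 : ℝ)))).exists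
  have hlow : ∀ x ∈ N, x.2 ≤ 0 → f (p + e x) = p + e x := fun x hx hx2 =>
    (hf _).2 (hfix r hr) _ (hdom x hx _ hrN (Or.inr ⟨hr, hx2⟩))
  obtain ⟨A, hA⟩ := (hf (p + e (0, t))).1
  have hup : ∀ x ∈ N, 0 ≤ x.2 → f (p + e x) = A (p + e x) := fun x hx hx2 =>
    hA _ (hdom x hx _ htN (Or.inl ⟨ht, hx2⟩))
  have hAp : ∀ x, A (p + e x) = A.linear (e x) + A p := fun x => by
    rw [add_comm p]
    exact A.map_vadd p (e x)
  have hAp0 : A p = p := by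
    have h := (hup 0 hN0 le_rfl).symm.trans (hlow 0 hN0 le_rfl)
    simpa using h
  have hAv : A.linear (e (1, 0)) = e (1, 0) := by
    have h := (hup _ huN le_rfl).symm.trans (hlow _ huN le_rfl)
    rw [hAp, hAp0, add_comm, add_right_inj,
      show ((u, 0) : ℝ × ℝ) = u • ((1, 0) : ℝ × ℝ) by ext <;> simp, map_smul, map_smul] at h
    exact smul_right_injective _ (ne_of_gt (Set.mem_Ioi.1 hu)) h
  obtain ⟨⟨a, b⟩, hab⟩ := e.surjective (A.linear (e (0, 1)))
  have hshear : ∀ x ∈ N, 0 ≤ x.2 → f (p + e x) = p + e (shear a b x) := by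
    intro x hx hx2
    rw [hup x hx hx2, hAp, hAp0, add_comm]
    congr 1
    rw [show shear a b x = x.1 • ((1, 0) : ℝ × ℝ) + x.2 • ((a, b) : ℝ × ℝ) by
      ext <;> simp [shear, mul_comm], map_add, map_smul, map_smul, hab]
    conv_lhs => rw [show x = x.1 • ((1, 0) : ℝ × ℝ) + x.2 • ((0, 1) : ℝ × ℝ) by ext <;> simp]
    rw [map_add, map_smul, map_smul, map_add, map_smul, map_smul, hAv]
  refine ⟨a, b, ?_, ?_⟩
  · by_contra hb
    push Not at hb
    have hc : Continuous fun t : ℝ => shear a b (0, t) := by unfold shear; fun_prop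
    have hc0 : shear a b (0, 0) = 0 := by simp [shear]
    have hev : ∀ᶠ t : ℝ in 𝓝 0, shear a b (0, t) ∈ N :=
      hc.tendsto' 0 0 hc0 hN
    obtain ⟨t, ⟨h1, h2⟩, ht⟩ := (((hvert.and hev).filter_mono nhdsWithin_le_nhds).and
      (self_mem_nhdsWithin (s := Set.Ioi (0 : ℝ)))).exists
    replace ht : 0 < t := ht
    have h3 : b * t ≤ 0 := mul_nonpos_of_nonpos_of_nonneg hb ht.le
    have h4 := e.injective (add_left_cancel
      (f.injective ((hshear _ h1 ht.le).trans (hlow _ h2 h3).symm)))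
    have h5 : t = b * t := congrArg Prod.snd h4
    linarith
  · filter_upwards [mem_nhdsWithin_of_mem_nhds hN, self_mem_nhdsWithin] with x hx hx2
    exact hshear x hx hx2

end Chart

/-- A finitely generated group of cellwise affine permutations of the plane with bounded support is
indicable. A line in general direction through a moved point is followed, from infinity, up to the
first point `p` where the generators cease to act trivially. By the choice of direction, `p` lies on
a single line of the arrangement; behind it the group is trivial, and beyond it the generators are
shears. -/
theorem indicable_of_cellAffinePerm {G : Type*} [Group G] (ψ : G →* Equiv.Perm (ℝ × ℝ))
    (S : Finset G) (hS : Subgroup.closure (S : Set G) = ⊤) (F : Finset (ℝ × ℝ →ᵃ[ℝ] ℝ))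
    (hF : ∀ s ∈ S, CellAffinePerm F (ψ s)) {X : Set (ℝ × ℝ)} (hX : Bornology.IsBounded X)
    (hSX : ∀ s ∈ S, ∀ x ∉ X, ψ s x = x) (hne : ∃ s ∈ S, ψ s ≠ 1) : Indicable G := by
  classical
  let Z : Set (ℝ × ℝ) := {x | ∀ s ∈ S, ψ s x = x}
  have hZ : ∀ x ∈ Z, ∀ y, Dom F y x → y ∈ Z := fun x hx y hy s hs => (hF s hs x).2 (hx s hs) y hy
  obtain ⟨q, hq⟩ : ∃ q, q ∉ Z := by
    obtain ⟨s, hs, hs1⟩ := hne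
    by_contra hc
    push Not at hc
    exact hs1 (Equiv.ext fun x => hc x s hs)
  -- A nonzero functional of the last family is the linear part of an affine function that vanishes
  -- at `q` and at every common zero of `l.1` and `l.2`. A direction on which it does not vanish
  -- avoids the crossings of the lines.
  let D : Finset (ℝ × ℝ →ₗ[ℝ] ℝ) := {LinearMap.fst ℝ ℝ ℝ} ∪ F.image (fun l => l.linear) ∪
    (F ×ˢ F).image fun l => l.1 q • l.2.linear - l.2 q • l.1.linear
  obtain ⟨w, hw⟩ : ∃ w, ∀ μ ∈ D, μ ≠ 0 → μ w ≠ 0 := by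
    obtain ⟨w, hw⟩ := Module.Dual.exists_forall_ne_zero_of_forall_exists
      (fun μ : D.filter (· ≠ 0) => (μ.1 : Module.Dual ℝ (ℝ × ℝ))) fun μ => by
        by_contra hc
        push Not at hc
        exact (Finset.mem_filter.1 μ.2).2 (LinearMap.ext hc)
    exact ⟨w, fun μ h1 h2 => hw ⟨μ, Finset.mem_filter.2 ⟨h1, h2⟩⟩⟩
  have hfst : LinearMap.fst ℝ ℝ ℝ w ≠ 0 := hw _ (by simp [D]) fun h => by
    simpa using LinearMap.congr_fun h (1, 0)
  have hw0 : 0 < ‖w‖ := norm_pos_iff.2 fun h => hfst (by rw [h, map_zero])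
  let T : Set ℝ := {t | q + t • w ∉ Z}
  have hT0 : (0 : ℝ) ∈ T := by simpa [T] using hq
  have hTb : BddBelow T := by
    obtain ⟨R, hR⟩ := hX.exists_norm_le
    refine ⟨-((R + ‖q‖) / ‖w‖), fun t ht => ?_⟩
    have hmem : q + t • w ∈ X := by
      by_contra hc
      exact ht fun s hs => hSX s hs _ hc
    have h1 : |t| * ‖w‖ ≤ R + ‖q‖ := by
      rw [← Real.norm_eq_abs, ← norm_smul]
      calc ‖t • w‖ = ‖(q + t • w) - q‖ := by rw [add_sub_cancel_left]
        _ ≤ ‖q + t • w‖ + ‖q‖ := norm_sub_le _ _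
        _ ≤ R + ‖q‖ := by gcongr; exact hR _ hmem
    exact neg_le_of_abs_le ((le_div_iff₀ hw0).2 h1)
  let τ : ℝ := sInf T
  let p : ℝ × ℝ := q + τ • w
  have hlow : ∀ t < (0 : ℝ), p + t • w ∈ Z := fun t ht => by
    have h : τ + t ∉ T := notMem_of_lt_csInf (show τ + t < sInf T by simp only [τ]; linarith) hTb
    rw [show p + t • w = q + (τ + t) • w by simp only [p]; rw [add_smul, add_assoc]]
    exact not_not.1 h
  have hpZ : p ∈ Z := by
    have hc : Continuous fun t : ℝ => p + t • w := by fun_prop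
    have hev : ∀ᶠ t : ℝ in 𝓝 0, Dom F p (p + t • w) :=
      hc.tendsto' 0 p (by simp) (eventually_dom F p)
    obtain ⟨t, h1, ht⟩ := ((hev.filter_mono nhdsWithin_le_nhds).and
      (self_mem_nhdsWithin (s := Set.Iio (0 : ℝ)))).exists
    exact hZ _ (hlow t ht) _ h1
  have hτ : τ ≠ 0 := fun h => hq <| by simpa [p, h] using hpZ
  have hq_eq : ∀ l : ℝ × ℝ →ᵃ[ℝ] ℝ, l p = 0 → l q = -τ * l.linear w := by
    intro l hl
    have : l p = l.linear (τ • w) + l q := by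
      simp only [p]
      rw [add_comm q]
      exact l.map_vadd q (τ • w)
    rw [hl, map_smul, smul_eq_mul] at this
    linarith
  obtain ⟨lam, hlam, hprop⟩ : ∃ lam : ℝ × ℝ →ₗ[ℝ] ℝ, lam w ≠ 0 ∧
      ∀ l ∈ F, l p = 0 → ∃ c : ℝ, l.linear = c • lam := by
    -- the line of the arrangement through `p`, if there is one, is the zero set of some `l`
    by_cases hex : ∃ l ∈ F, l p = 0 ∧ l.linear ≠ 0
    · obtain ⟨l, hl, hlp, hl0⟩ := hex
      have hlw : l.linear w ≠ 0 := hw _ (by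
        simp only [D, Finset.mem_union, Finset.mem_image]
        exact Or.inl (Or.inr ⟨l, hl, rfl⟩)) hl0
      have hlq : l q ≠ 0 := by
        rw [hq_eq l hlp]
        exact mul_ne_zero (neg_ne_zero.2 hτ) hlw
      refine ⟨l.linear, hlw, fun l' hl' hlp' => ⟨l' q / l q, ?_⟩⟩
      -- both functions vanish at `p`, so this functional of `D` kills `w` and must be zero
      have hμ : l q • l'.linear - l' q • l.linear = 0 := by
        by_contra hc
        refine hw _ ?_ hc ?_
        · simp only [D, Finset.mem_union, Finset.mem_image]
          exact Or.inr ⟨(l, l'), Finset.mem_product.2 ⟨hl, hl'⟩, rfl⟩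
        · rw [LinearMap.sub_apply, LinearMap.smul_apply, LinearMap.smul_apply, hq_eq l hlp,
            hq_eq l' hlp', smul_eq_mul, smul_eq_mul]
          ring
      rw [div_eq_inv_mul, mul_smul, ← sub_eq_zero.1 hμ, smul_smul, inv_mul_cancel₀ hlq, one_smul]
    · push Not at hex
      exact ⟨LinearMap.fst ℝ ℝ ℝ, hfst, fun l hl hlp => ⟨0, by rw [hex l hl hlp, zero_smul]⟩⟩
  obtain ⟨e, hew, hev⟩ := exists_chart lam w hlam
  have het : ∀ t : ℝ, e (0, t) = t • w := fun t => by
    rw [← hew, ← map_smul]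
    simp
  have he : ∀ l ∈ F, l p = 0 → l.linear (e (1, 0)) = 0 := fun l hl hlp => by
    obtain ⟨c, hc⟩ := hprop l hl hlp
    rw [hc, LinearMap.smul_apply, hev, smul_zero]
  refine indicable_of_shearGerm (P := fun x => p + e x)
    (fun x y h => e.injective (add_left_cancel h)) ψ S hS (fun s hs => ?_) ?_
  · exact exists_shearGerm he (hF s hs) fun t ht => by
      rw [het]
      exact hlow t ht s hs
  · -- otherwise the group would act trivially on the line a little beyond `p`
    by_contra hc
    push Not at hc
    have hall : ∀ᶠ t : ℝ in 𝓝[>] 0, p + t • w ∈ Z := by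
      refine (Filter.eventually_all_finset S).2 fun s hs => ?_
      filter_upwards [tendsto_vertical.eventually (hc s hs).2] with t ht
      simpa [shear, het] using ht
    obtain ⟨δ, hδ, hδZ⟩ := mem_nhdsGT_iff_exists_Ioo_subset.1 hall
    obtain ⟨t, htT, ht⟩ := exists_lt_of_csInf_lt ⟨0, hT0⟩
      (show sInf T < τ + δ from lt_add_of_pos_right _ hδ)
    refine htT ?_
    rcases (csInf_le hTb htT).eq_or_lt with h | h
    · rw [← h]
      exact hpZ
    · have h1 := hδZ (show t - τ ∈ Set.Ioo 0 δ from ⟨sub_pos.2 h, by linarith⟩)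
      have h2 : p + (t - τ) • w = q + t • w := by
        simp only [p]
        rw [add_assoc, ← add_smul, add_sub_cancel]
      exact h2 ▸ h1

/-! ### Piecewise linear homeomorphisms of the square -/

open Classical in
/-- Extension by the identity of homeomorphisms of the square to permutations of the plane. -/
noncomputable def extendPlane : (square ≃ₜ square) →* Equiv.Perm (ℝ × ℝ) where
  toFun f := Equiv.Perm.ofSubtype (p := (· ∈ square)) f.toEquiv
  map_one' := map_one Equiv.Perm.ofSubtype
  map_mul' f g := map_mul Equiv.Perm.ofSubtype f.toEquiv g.toEquiv

theorem extendPlane_of_mem (f : square ≃ₜ square) {x : ℝ × ℝ} (hx : x ∈ square) :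
    extendPlane f x = f ⟨x, hx⟩ := by
  classical exact Equiv.Perm.ofSubtype_apply_of_mem _ hx

theorem extendPlane_of_notMem (f : square ≃ₜ square) {x : ℝ × ℝ} (hx : x ∉ square) :
    extendPlane f x = x := by
  classical exact Equiv.Perm.ofSubtype_apply_of_not_mem _ hx

theorem extendPlane_injective : Function.Injective extendPlane := fun f g h =>
  Homeomorph.ext fun x => Subtype.ext <| by
    have := Equiv.congr_fun h x
    rwa [extendPlane_of_mem f x.2, extendPlane_of_mem g x.2] at this

theorem mem_frontier_square {x : ℝ × ℝ} (hx : x ∈ square)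
    (h : x.1 ≤ 0 ∨ x.2 ≤ 0 ∨ 1 - x.1 ≤ 0 ∨ 1 - x.2 ≤ 0) : x ∈ frontier square := by
  refine ⟨subset_closure hx, fun hi => ?_⟩
  rw [square, interior_prod_eq, interior_Icc] at hi
  obtain ⟨⟨h1, h2⟩, h3, h4⟩ := hi
  rcases h with h | h | h | h <;> linarith

theorem exists_cellAffinePerm_extendPlane (f : PLSquare) :
    ∃ F, CellAffinePerm F (extendPlane f) := by
  classical
  obtain ⟨⟨f, hf, hfr⟩⟩ := f, f.2
  obtain ⟨F, Q, hQ⟩ := hf.cellAffine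
  let a : ℝ × ℝ →ᵃ[ℝ] ℝ := (LinearMap.fst ℝ ℝ ℝ).toAffineMap
  let b : ℝ × ℝ →ᵃ[ℝ] ℝ := (LinearMap.snd ℝ ℝ ℝ).toAffineMap
  let k : ℝ × ℝ →ᵃ[ℝ] ℝ := AffineMap.const ℝ _ 1
  -- The coordinates of `A x - x`, for `A ∈ Q`, cut the fixed point sets into cells.
  let F' : Finset (ℝ × ℝ →ᵃ[ℝ] ℝ) := F ∪ {a, b, k - a, k - b} ∪
    (Q.image (fun A => a.comp A - a) ∪ Q.image fun A => b.comp A - b)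
  refine ⟨F', fun x => ?_⟩
  by_cases hx : x ∈ square
  · obtain ⟨A, hA, hAx⟩ := hQ x hx
    have hfA : ∀ y, Dom F' y x → extendPlane f y = A y := fun y hy => by
      obtain ⟨hy', h⟩ := hAx y (hy.mono (by simp only [F', Finset.union_assoc]
                                            exact Finset.subset_union_left))
      rw [extendPlane_of_mem f hy', h]
    refine ⟨⟨A, hfA⟩, fun hfx y hy => ?_⟩
    rw [hfA y hy]
    rw [hfA x (Dom.refl _ x)] at hfx
    have h1 := hy (a.comp A - a) (by
      simp only [F', Finset.mem_union, Finset.mem_image]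
      exact Or.inr (Or.inl ⟨A, hA, rfl⟩))
    have h2 := hy (b.comp A - b) (by
      simp only [F', Finset.mem_union, Finset.mem_image]
      exact Or.inr (Or.inr ⟨A, hA, rfl⟩))
    simp only [a, b, AffineMap.coe_sub, Pi.sub_apply, AffineMap.coe_comp, Function.comp_apply,
      LinearMap.coe_toAffineMap, LinearMap.fst_apply, LinearMap.snd_apply, hfx, sub_self, le_refl,
      true_implies] at h1 h2
    exact Prod.ext (by linarith) (by linarith)
  · have hid : ∀ y, Dom F' y x → extendPlane f y = y := fun y hy => by
      by_cases hy' : y ∈ square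
      · have h1 := hy a (by simp [F'])
        have h2 := hy b (by simp [F'])
        have h3 := hy (k - a) (by simp [F'])
        have h4 := hy (k - b) (by simp [F'])
        simp only [a, b, k, AffineMap.coe_sub, Pi.sub_apply, AffineMap.const_apply,
          LinearMap.coe_toAffineMap, LinearMap.fst_apply, LinearMap.snd_apply] at h1 h2 h3 h4
        rw [extendPlane_of_mem f hy', hfr ⟨y, hy'⟩ (mem_frontier_square hy' ?_)]
        by_contra hc
        push Not at hc
        refine hx ⟨⟨?_, ?_⟩, ?_, ?_⟩ <;> by_contra hn
        · linarith [h1.2 (not_le.1 hn).le]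
        · linarith [h3.2 (by linarith)]
        · linarith [h2.2 (not_le.1 hn).le]
        · linarith [h4.2 (by linarith)]
      · exact extendPlane_of_notMem f hy'
    exact ⟨⟨AffineMap.id ℝ _, hid⟩, fun _ => hid⟩

theorem locallyIndicable_PLSquare : LocallyIndicable PLSquare := by
  classical
  intro H hH hfg
  obtain ⟨S, hS⟩ := (Group.fg_iff_subgroup_fg H).2 hfg
  choose F hF using exists_cellAffinePerm_extendPlane
  refine indicable_of_cellAffinePerm ((extendPlane.comp PLSquare.subtype).comp H.subtype) S hS
    (S.biUnion fun s => F s)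
    (fun s hs => (hF s).mono (Finset.subset_biUnion_of_mem (fun s : H => F s) hs))
    isBounded_square (fun s _ x hx => extendPlane_of_notMem _ hx) ?_
  by_contra hc
  push Not at hc
  have hS1 : (S : Set H) ⊆ {1} := fun s hs =>
    Subtype.ext (Subtype.ext (extendPlane_injective ((hc s hs).trans (map_one _).symm)))
  have hbot : (⊤ : Subgroup H) = ⊥ := by
    rw [← hS, Subgroup.closure_eq_bot_iff]
    exact hS1
  exact hH ((Subgroup.eq_bot_iff_forall H).2 fun x hx => by
    have : (⟨x, hx⟩ : H) ∈ (⊥ : Subgroup H) := hbot ▸ Subgroup.mem_top _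
    exact congrArg Subtype.val (Subgroup.mem_bot.1 this))

end PLHomeo

theorem mainTheorem1 :
    PLHomeo.LocallyIndicable PLHomeo.PLSquare ∧ PLHomeo.LeftOrderable PLHomeo.PLSquare :=
  ⟨PLHomeo.locallyIndicable_PLSquare, PLHomeo.locallyIndicable_PLSquare.leftOrderable⟩
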